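/- Let $F$ be a finite real abelian extension of $\mathbb Q$ and let $M$ be an odd positive integer. Let $\mathbf r$ be the formal product of all odd primes $\ell\equiv 1 \bmod M$ that split completely in $F$, and for a formal product $\mathbf s$ of some of these primes let $\frac1{\mathbf s}\mathbb Z/\mathbb Z=\bigcup_{s\mid\mathbf s}\frac1s\mathbb Z/\mathbb Z$ ($s$ ranging over the positive integers dividing $\mathbf s$). Let $F_{\mathbf r}$ be the field generated over $F$ by all roots of unity of order dividing $\mathbf r$ and let $G=\mathrm{Gal}(F_{\mathbf r}/F)$. It acts on $\frac1{\mathbf s}\mathbb Z/\mathbb Z$ by the rule $\sigma a=b\Leftrightarrow\sigma\phi(a)=\phi(b)$ for every injective homomorphism $\phi:\frac1{\mathbf r}\mathbb Z/\mathbb Z\to F_{\mathbf r}^\times$. Let $\mathcal A(\mathbf s)$ be the free abelian group on the symbols $[a]$, $a\in\frac1{\mathbf s}\mathbb Z/\mathbb Z$, with the $G$-action $\sigma[a]=[\sigma a]$, and let $U_{\mathbf s}$ be the quotient of $\mathcal A(\mathbf s)$ by the subgroup generated by all elements $[a]-\sum_{pb=a}[b]$ with $p$ a prime dividing $\mathbf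 s$ and $a\in\frac p{\mathbf s}\mathbb Z/\mathbb Z$. Put $U=U_{\mathbf r}$. For $\mathbf s\mid\mathbf s'$ there are natural $G$-equivariant maps $U_{\mathbf s}\to U_{\mathbf s'}$ and $H^0(G,U_{\mathbf s}/MU_{\mathbf s})\to H^0(G,U_{\mathbf s'}/MU_{\mathbf s'})$ given by $[a]\mapsto[a]$. Let $\ell$ be a prime dividing $\mathbf r$. Let $\sigma_\ell\in G$ be a generator of the inertia subgroup $G_\ell$ at some place of $F_{\mathbf r}$ above $\ell$, and let $\mathrm{Frob}_\ell\in G/G_\ell$ be the arithmetic Frobenius at some place above $\ell$; it acts on $U_{\mathbf r/\ell}$ through any representative in $G$. Let $I_\ell\subset U$ be the subgroup generated by the classes of all $[a]-[b]$ with $a,b\in\frac1{\mathbf r}\mathbb Z/\mathbb Z$ and $a-b\in\frac1\ell\mathbb Z/\mathbb Z$. Then for every $x\in U$ representing a class in $H^0(G,U/MU)$ there is a unique element $\frac{(\sigma_\ell-1)x}{M}$ of $U$ whose product with $M$ is $(\sigma_\ell-1)x$, and for every $y\in U_{\mathbf r/\ell}$ representing a class in $H^0(G,U_{\mathbf r/\ell}/MU_{\mathbf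 r/\ell})$ there is a unique element $\frac{(\ell-\mathrm{Frob}_\ell)y}{M}$ of $U_{\mathbf r/\ell}$ whose product with $M$ is $(\ell-\mathrm{Frob}_\ell)y$. There exists a unique homomorphism $$D_\ell:H^0(G,U/MU)\to H^0(G,U_{\mathbf r/\ell}/MU_{\mathbf r/\ell})$$ such that for all such $x$ and $y$ $$\frac{(\sigma_\ell-1)x}{M}\equiv\frac{(\ell-\mathrm{Frob}_\ell)y}{M}\bmod I_\ell\iff D_\ell(x\bmod MU)=y\bmod MU_{\mathbf r/\ell},$$ where the congruence is between elements of $U$, the right side being mapped to $U$ by the natural map $U_{\mathbf r/\ell}\to U$. Moreover, for every positive integer $r$ dividing $\mathbf r$ and divisible by $\ell$, $D_\ell$ maps the image of $H^0(G,U_r/MU_r)$ in $H^0(G,U/MU)$ into the image of $H^0(G,U_{r/\ell}/MU_{r/\ell})$ in $H^0(G,U_{\mathbf r/\ell}/MU_{\mathbf r/\ell})$. -/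

import Mathlib

open NumberField

noncomputable section

namespace UnivDist

/-- A prime number `ℓ` splits completely in the number field `F`: there are exactly `[F : ℚ]`
prime ideals of the ring of integers of `F` above `ℓ`. -/
def SplitsCompletely (F : Type*) [Field F] [NumberField F] (ℓ : ℕ) : Prop :=
  (Ideal.primesOver (Ideal.span {(ℓ : ℤ)}) (𝓞 F)).ncard = Module.finrank ℚ F

/-- The set of prime factors of the supernatural number `𝐫`: the odd primes `ℓ ≡ 1 mod M` that
split completely in `F`. -/
structure IsKolyvaginPrime (F : Type*) [Field F] [NumberField F] (M ℓ : ℕ) : Prop where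
  prime : ℓ.Prime
  odd : Odd ℓ
  modEq : ℓ ≡ 1 [MOD M]
  splits : SplitsCompletely F ℓ

/-- The type of the prime numbers dividing the supernatural number `𝐫`. As `𝐫` is squarefree, a
supernatural number `𝐬` dividing `𝐫` is the same thing as a set `S : Set (KPrime F M)`;
`𝐫` itself is `Set.univ`, and `𝐫/ℓ` is `{ℓ}ᶜ`. -/
abbrev KPrime (F : Type*) [Field F] [NumberField F] (M : ℕ) : Type :=
  {ℓ : ℕ // IsKolyvaginPrime F M ℓ}

variable {F : Type*} [Field F] [NumberField F] {M : ℕ}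

/-- The positive integer `n` divides the supernatural number `∏_{p ∈ S} p`. -/
structure DividesSuper (n : ℕ) (S : Set (KPrime F M)) : Prop where
  squarefree : Squarefree n
  mem : ∀ p : ℕ, p.Prime → p ∣ n → ∃ h : IsKolyvaginPrime F M p, (⟨p, h⟩ : KPrime F M) ∈ S

/-- The set of prime factors of a positive integer `r` dividing `𝐫`: it is the positive integer `r`
viewed as a supernatural number dividing `𝐫`. -/
def level (F : Type*) [Field F] [NumberField F] (M r : ℕ) : Set (KPrime F M) :=
  {p | (p : ℕ) ∣ r}

theorem DividesSuper.mono {n : ℕ} {S S' : Set (KPrime F M)} (h : S ⊆ S') (hn : DividesSuper n S) :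
    DividesSuper n S' :=
  ⟨hn.squarefree, fun p hp hd => (hn.mem p hp hd).imp fun _ hx => h hx⟩

theorem dividesSuper_one (S : Set (KPrime F M)) : DividesSuper 1 S :=
  ⟨squarefree_one, fun _ hp h => absurd (Nat.dvd_one.mp h) hp.ne_one⟩

theorem DividesSuper.lcm {m n : ℕ} {S : Set (KPrime F M)} (hm : DividesSuper m S)
    (hn : DividesSuper n S) : DividesSuper (m.lcm n) S := by
  refine ⟨?_, fun p hp h => ?_⟩
  · have hm0 := hm.squarefree.ne_zero
    have hn0 := hn.squarefree.ne_zero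
    refine (Nat.squarefree_iff_factorization_le_one (Nat.lcm_ne_zero hm0 hn0)).2 fun p => ?_
    rw [Nat.factorization_lcm hm0 hn0, Finsupp.sup_apply]
    exact sup_le ((Nat.squarefree_iff_factorization_le_one hm0).1 hm.squarefree p)
      ((Nat.squarefree_iff_factorization_le_one hn0).1 hn.squarefree p)
  · rcases (hp.dvd_lcm).1 h with h | h
    exacts [hm.mem p hp h, hn.mem p hp h]

theorem DividesSuper.mul_prime {n : ℕ} {S : Set (KPrime F M)} {p : KPrime F M} (hp : p ∈ S)
    (hn : DividesSuper n (S \ {p})) : DividesSuper ((p : ℕ) * n) S := by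
  have hcop : ¬ (p : ℕ) ∣ n := fun h => by
    obtain ⟨_, h⟩ := hn.mem p p.2.prime h
    exact h.2 rfl
  refine ⟨(Nat.squarefree_mul ((Nat.Prime.coprime_iff_not_dvd p.2.prime).2 hcop)).2
    ⟨p.2.prime.prime.squarefree, hn.squarefree⟩, fun q hq h => ?_⟩
  rcases (Nat.Prime.dvd_mul hq).1 h with h | h
  · obtain rfl := (Nat.prime_dvd_prime_iff_eq hq p.2.prime).1 h
    exact ⟨p.2, hp⟩
  · exact (hn.mem q hq h).imp fun _ hx => hx.1

theorem level_div_subset_compl {r : ℕ} (hr : DividesSuper r (Set.univ : Set (KPrime F M)))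
    {ℓ : KPrime F M} (hℓ : (ℓ : ℕ) ∣ r) : level F M (r / ℓ) ⊆ {ℓ}ᶜ := by
  rintro p hp rfl
  obtain ⟨k, rfl⟩ := hℓ
  have h : (p : ℕ) ∣ k := by simpa [level, Nat.mul_div_cancel_left k p.2.prime.pos] using hp
  obtain ⟨m, rfl⟩ := h
  exact p.2.prime.ne_one (Nat.isUnit_iff.1 (hr.squarefree p ⟨m, by ring⟩))

/-! ### The fields and the Galois group -/

/-- `𝔽_𝐫`: the field generated over `F` by all roots of unity of order dividing `𝐫` in an algebraic
closure of `F`. -/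
abbrev CycField (F : Type*) [Field F] [NumberField F] (M : ℕ) :
    IntermediateField F (AlgebraicClosure F) :=
  IntermediateField.adjoin F
    {ζ | ∃ n : ℕ, DividesSuper n (Set.univ : Set (KPrime F M)) ∧ ζ ^ n = 1}

/-- The Galois group `G` of `𝔽_𝐫` over `F`. -/
abbrev GalGroup (F : Type*) [Field F] [NumberField F] (M : ℕ) : Type _ :=
  CycField F M ≃ₐ[F] CycField F M

/-- `σ` generates the inertia subgroup `G_ℓ ⊆ G` at some place of `𝔽_𝐫` above `ℓ`. -/
def IsInertiaGenerator (ℓ : KPrime F M) (σ : GalGroup F M) : Prop :=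
  ∃ Q : Ideal (𝓞 (CycField F M)), Q.IsPrime ∧ ((ℓ : ℕ) : 𝓞 (CycField F M)) ∈ Q ∧
    Subgroup.zpowers σ = Q.inertia (GalGroup F M)

instance : SMulCommClass (GalGroup F M) (𝓞 F) (𝓞 (CycField F M)) where
  smul_comm σ a x := by
    rw [Algebra.smul_def, Algebra.smul_def, smul_mul']
    congr 1
    ext1
    exact σ.commutes (a : F)

/-- `φ` is an arithmetic Frobenius (over `F`) at some place of `𝔽_𝐫` above `ℓ`. Such `φ` are the
elements of `G` that represent the Frobenius automorphism in `G/G_ℓ`. -/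
def IsFrobenius (ℓ : KPrime F M) (φ : GalGroup F M) : Prop :=
  ∃ Q : Ideal (𝓞 (CycField F M)), Q.IsPrime ∧ ((ℓ : ℕ) : 𝓞 (CycField F M)) ∈ Q ∧
    IsArithFrobAt (𝓞 F) φ Q

/-! ### The group `(1/𝐬)ℤ/ℤ` and the action of `G` -/

/-- The group `(1/𝐬)ℤ/ℤ`, as a subgroup of `ℚ/ℤ`: the union of the groups `(1/n)ℤ/ℤ`
(that is, of the `n`-torsion subgroups of `ℚ/ℤ`) over the positive integers `n` dividing `𝐬`. -/
def Frac (S : Set (KPrime F M)) : AddSubgroup (AddCircle (1 : ℚ)) where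
  carrier := {a | ∃ n : ℕ, DividesSuper n S ∧ n • a = 0}
  zero_mem' := ⟨1, dividesSuper_one S, smul_zero _⟩
  add_mem' := by
    rintro a b ⟨m, hm, ha⟩ ⟨n, hn, hb⟩
    refine ⟨m.lcm n, hm.lcm hn, ?_⟩
    obtain ⟨c, hc⟩ := Nat.dvd_lcm_left m n
    obtain ⟨d, hd⟩ := Nat.dvd_lcm_right m n
    rw [smul_add]
    nth_rewrite 1 [hc]
    rw [hd, mul_comm m, mul_comm n, mul_smul, mul_smul, ha, hb, smul_zero, smul_zero, add_zero]
  neg_mem' := by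
    rintro a ⟨m, hm, ha⟩
    exact ⟨m, hm, by rw [smul_neg, ha, neg_zero]⟩

theorem mem_frac {S : Set (KPrime F M)} {a : AddCircle (1 : ℚ)} :
    a ∈ Frac S ↔ ∃ n : ℕ, DividesSuper n S ∧ n • a = 0 := Iff.rfl

theorem frac_mono {S S' : Set (KPrime F M)} (h : S ⊆ S') : Frac S ≤ Frac S' :=
  fun _ ⟨n, hn, ha⟩ => ⟨n, hn.mono h, ha⟩

/-- The fractions are killed by an integer `n` with `DividesSuper n S`, so the order is positive. -/
theorem addOrderOf_dvd {S : Set (KPrime F M)} (a : Frac S) :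
    ∃ n : ℕ, DividesSuper n S ∧ n • a = 0 ∧ addOrderOf a ∣ n := by
  obtain ⟨n, hn, h⟩ := a.2
  have h' : n • a = 0 := Subtype.ext h
  exact ⟨n, hn, h', addOrderOf_dvd_of_nsmul_eq_zero h'⟩

instance {S : Set (KPrime F M)} (a : Frac S) : NeZero (addOrderOf a) := by
  obtain ⟨n, hn, -, h⟩ := addOrderOf_dvd a
  exact ⟨fun h0 => hn.squarefree.ne_zero (Nat.eq_zero_of_zero_dvd (h0 ▸ h))⟩

/-- The action of `σ ∈ G` on `(1/𝐬)ℤ/ℤ`: if `a` has order `m` and `σ ζ = ζ ^ k` for the `m`-th roots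
of unity `ζ` of `𝔽_𝐫`, then `σ a = k • a`. See `fracAct_spec` for the characterization. -/
def fracActFun (S : Set (KPrime F M)) (σ : GalGroup F M) (a : Frac S) : Frac S :=
  (modularCyclotomicCharacter.toFun (addOrderOf a) σ.toRingEquiv).val • a

theorem modEq_of_pow_eq {K : Type*} [Field K] {ζ : K} {n i j : ℕ} [NeZero n]
    (hζ : IsPrimitiveRoot ζ n) (h : ζ ^ i = ζ ^ j) : i ≡ j [MOD n] := by
  have h1 : (hζ.isUnit (NeZero.ne n)).unit ^ i = (hζ.isUnit (NeZero.ne n)).unit ^ j := by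
    ext; simpa using h
  have h2 := pow_eq_pow_iff_modEq.1 h1
  rwa [← orderOf_units, IsUnit.unit_spec, ← hζ.eq_orderOf] at h2

theorem exists_primitiveRoot {n : ℕ} (hn : DividesSuper n (Set.univ : Set (KPrime F M))) :
    ∃ ζ : CycField F M, IsPrimitiveRoot ζ n := by
  have : NeZero n := ⟨hn.squarefree.ne_zero⟩
  have : CharZero (AlgebraicClosure F) := charZero_of_injective_algebraMap
    (algebraMap F (AlgebraicClosure F)).injective
  have : NeZero (n : AlgebraicClosure F) := ⟨Nat.cast_ne_zero.2 (NeZero.ne n)⟩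
  obtain ⟨ζ, hζ⟩ := HasEnoughRootsOfUnity.exists_primitiveRoot (AlgebraicClosure F) n
  refine ⟨⟨ζ, IntermediateField.subset_adjoin _ _ ⟨n, hn, hζ.pow_eq_one⟩⟩, ?_⟩
  exact IsPrimitiveRoot.of_map_of_injective (f := (CycField F M).val) hζ
    (CycField F M).val.injective

/-- One exponent works for all fractions with denominator `n`. -/
theorem exists_fracActFun_eq {n : ℕ} (hn : DividesSuper n (Set.univ : Set (KPrime F M)))
    (σ : GalGroup F M) : ∃ k : ℕ, (∀ ζ : CycField F M, ζ ^ n = 1 → σ ζ = ζ ^ k) ∧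
      ∀ (S : Set (KPrime F M)) (a : Frac S), n • a = 0 → fracActFun S σ a = k • a := by
  have : NeZero n := ⟨hn.squarefree.ne_zero⟩
  have key (m : ℕ) [NeZero m] (ζ : CycField F M) (h : ζ ^ m = 1) :
      σ ζ = ζ ^ (modularCyclotomicCharacter.toFun m σ.toRingEquiv).val := by
    have h1 := modularCyclotomicCharacter.toFun_spec' σ.toRingEquiv (n := m)
      (t := Units.ofPowEqOne ζ m h (NeZero.ne m))
      (by rw [mem_rootsOfUnity]; ext; simp)
    exact h1
  refine ⟨_, key n, fun S a ha => ?_⟩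
  obtain ⟨ζ, hζ⟩ := exists_primitiveRoot hn
  obtain ⟨e, he⟩ := addOrderOf_dvd_of_nsmul_eq_zero ha
  have hζ' : IsPrimitiveRoot (ζ ^ e) (addOrderOf a) :=
    hζ.pow (NeZero.pos n) (by rw [he, mul_comm])
  have h1 := key (addOrderOf a) _ hζ'.pow_eq_one
  rw [key n (ζ ^ e) (by rw [← pow_mul, mul_comm, pow_mul, hζ.pow_eq_one, one_pow])] at h1
  unfold fracActFun
  rw [nsmul_eq_nsmul_iff_modEq]
  exact modEq_of_pow_eq hζ' h1.symm

theorem fracActFun_add {S : Set (KPrime F M)} (σ : GalGroup F M) (a b : Frac S) :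
    fracActFun S σ (a + b) = fracActFun S σ a + fracActFun S σ b := by
  obtain ⟨m, hm, ha⟩ := a.2
  obtain ⟨n, hn, hb⟩ := b.2
  obtain ⟨k, -, hk⟩ := exists_fracActFun_eq ((hm.lcm hn).mono (Set.subset_univ S)) σ
  have ha' : m.lcm n • a = 0 := by
    obtain ⟨c, hc⟩ := Nat.dvd_lcm_left m n
    rw [hc, mul_comm, mul_smul, show m • a = 0 from Subtype.ext ha, smul_zero]
  have hb' : m.lcm n • b = 0 := by
    obtain ⟨c, hc⟩ := Nat.dvd_lcm_right m n
    rw [hc, mul_comm, mul_smul, show n • b = 0 from Subtype.ext hb, smul_zero]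
  rw [hk S a ha', hk S b hb', hk S (a + b) (by rw [smul_add, ha', hb', add_zero]), smul_add]

/-- The action of `G` on `(1/𝐬)ℤ/ℤ`. -/
def fracAct (S : Set (KPrime F M)) : GalGroup F M →* AddMonoid.End (Frac S) where
  toFun σ := AddMonoidHom.mk' (fracActFun S σ) (fracActFun_add σ)
  map_one' := by
    ext1 a
    obtain ⟨n, hn, ha, -⟩ := addOrderOf_dvd a
    obtain ⟨k, hk, hk'⟩ := exists_fracActFun_eq (hn.mono (Set.subset_univ S)) 1
    obtain ⟨ζ, hζ⟩ := exists_primitiveRoot (hn.mono (Set.subset_univ S))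
    have h1 : ζ ^ 1 = ζ ^ k := by simpa using hk ζ hζ.pow_eq_one
    have : NeZero n := ⟨hn.squarefree.ne_zero⟩
    have h2 := modEq_of_pow_eq hζ h1
    change fracActFun S 1 a = a
    rw [hk' S a ha]
    conv_rhs => rw [← one_smul ℕ a]
    exact nsmul_eq_nsmul_iff_modEq.2 ((h2.of_dvd (addOrderOf_dvd_of_nsmul_eq_zero ha)).symm)
  map_mul' σ τ := by
    ext1 a
    obtain ⟨n, hn, ha, -⟩ := addOrderOf_dvd a
    have hn' := hn.mono (Set.subset_univ S)
    obtain ⟨k, hk, hk'⟩ := exists_fracActFun_eq hn' (σ * τ)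
    obtain ⟨i, hi, hi'⟩ := exists_fracActFun_eq hn' σ
    obtain ⟨j, hj, hj'⟩ := exists_fracActFun_eq hn' τ
    obtain ⟨ζ, hζ⟩ := exists_primitiveRoot hn'
    have h1 : ζ ^ (i * j) = ζ ^ k := by
      rw [← hk ζ hζ.pow_eq_one, AlgEquiv.mul_apply, hj ζ hζ.pow_eq_one, map_pow,
        hi ζ hζ.pow_eq_one, ← pow_mul]
    have : NeZero n := ⟨hn.squarefree.ne_zero⟩
    have h2 := modEq_of_pow_eq hζ h1
    change fracActFun S (σ * τ) a = fracActFun S σ (fracActFun S τ a)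
    rw [hk' S a ha, hj' S a ha, hi' S (j • a) (by rw [smul_comm, ha, smul_zero]), smul_smul]
    exact nsmul_eq_nsmul_iff_modEq.2 ((h2.of_dvd (addOrderOf_dvd_of_nsmul_eq_zero ha)).symm)

/-- The action is characterized by the rule `σ φ(a) = φ(b) ↔ σ a = b`, for every
injective homomorphism `φ` of `(1/𝐬)ℤ/ℤ` into the multiplicative group of `𝔽_𝐫`. -/
theorem fracAct_spec (S : Set (KPrime F M)) (φ : Multiplicative (Frac S) →* (CycField F M)ˣ)
    (hφ : Function.Injective φ) (σ : GalGroup F M) (a b : Frac S) :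
    σ (φ (Multiplicative.ofAdd a) : CycField F M) = φ (Multiplicative.ofAdd b) ↔
      fracAct S σ a = b := by
  obtain ⟨n, hn, ha, -⟩ := addOrderOf_dvd a
  obtain ⟨k, hk, hk'⟩ := exists_fracActFun_eq (hn.mono (Set.subset_univ S)) σ
  have h1 : (φ (Multiplicative.ofAdd a) : CycField F M) ^ n = 1 := by
    rw [← Units.val_pow_eq_pow_val, ← map_pow, ← ofAdd_nsmul, ha, ofAdd_zero, map_one,
      Units.val_one]
  rw [hk _ h1, ← Units.val_pow_eq_pow_val, ← map_pow, ← ofAdd_nsmul, Units.val_inj, hφ.eq_iff,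
    Multiplicative.ofAdd.injective.eq_iff, ← hk' S a ha]
  rfl

/-! ### The universal ordinary distribution -/

/-- `𝒜(𝐬)`: the free abelian group on the symbols `[a]`, `a ∈ (1/𝐬)ℤ/ℤ`. -/
abbrev FreeSym (S : Set (KPrime F M)) : Type := Frac S →₀ ℤ

/-- The symbol `[a]`. -/
abbrev sym {S : Set (KPrime F M)} (a : Frac S) : FreeSym S := Finsupp.single a 1

theorem finite_fiber {S : Set (KPrime F M)} (p : KPrime F M) (a : Frac S) :
    {b : Frac S | (p : ℕ) • b = a}.Finite := by
  have hp : (p : ℕ) ≠ 0 := p.2.prime.ne_zero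
  have h0 : {x : AddCircle (1 : ℚ) | (p : ℕ) • x = 0}.Finite :=
    AddCircle.finite_torsion_of_isSMulRegular 1 p
      (fun x y h => by simpa [hp] using h)
  rcases Set.eq_empty_or_nonempty {b : Frac S | (p : ℕ) • b = a} with h | ⟨b₀, hb₀⟩
  · rw [h]; exact Set.finite_empty
  · refine Set.Finite.of_finite_image (f := fun b : Frac S => ((b - b₀ : Frac S) :
      AddCircle (1 : ℚ))) (h0.subset ?_) (fun x _ y _ h => by simpa using h)
    rintro _ ⟨b, hb, rfl⟩
    have hb1 : (p : ℕ) • b = a := hb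
    have hb2 : (p : ℕ) • b₀ = a := hb₀
    have : (p : ℕ) • (b - b₀) = 0 := by rw [smul_sub, hb1, hb2, sub_self]
    simpa using congrArg Subtype.val this

/-- The finite set of all `b` such that `p b = a`. -/
def fiber {S : Set (KPrime F M)} (p : KPrime F M) (a : Frac S) : Finset (Frac S) :=
  (finite_fiber p a).toFinset

theorem mem_fiber {S : Set (KPrime F M)} {p : KPrime F M} {a b : Frac S} :
    b ∈ fiber p a ↔ (p : ℕ) • b = a := by
  simp [fiber]

/-- The element `[a] - ∑_{p b = a} [b]`. -/
def distRel {S : Set (KPrime F M)} (p : KPrime F M) (a : Frac S) : FreeSym S :=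
  sym a - ∑ b ∈ fiber p a, sym b

/-- The subgroup generated by the elements `[a] - ∑_{p b = a} [b]` with `p ∣ 𝐬` prime and
`a ∈ (p/𝐬)ℤ/ℤ`. -/
def relations (S : Set (KPrime F M)) : Submodule ℤ (FreeSym S) :=
  Submodule.span ℤ {x | ∃ p ∈ S, ∃ a : Frac S, (a : AddCircle (1 : ℚ)) ∈ Frac (S \ {p}) ∧
    x = distRel p a}

/-- The universal ordinary distribution `U_𝐬` of level `𝐬`. -/
abbrev UDist (S : Set (KPrime F M)) : Type := FreeSym S ⧸ relations S

/-- The action of `σ` on `𝒜(𝐬)`. -/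
def freeSymRep (S : Set (KPrime F M)) : Representation ℤ (GalGroup F M) (FreeSym S) where
  toFun σ := Finsupp.lmapDomain ℤ ℤ (fracAct S σ)
  map_one' := by ext; simp
  map_mul' σ τ := by
    ext : 2
    simp [Finsupp.mapDomain_single]

theorem freeSymRep_sym {S : Set (KPrime F M)} (σ : GalGroup F M) (a : Frac S) :
    freeSymRep S σ (sym a) = sym (fracAct S σ a) := by
  simp [freeSymRep, Finsupp.mapDomain_single]

theorem fracAct_inv_apply {S : Set (KPrime F M)} (σ : GalGroup F M) (a : Frac S) :
    fracAct S σ⁻¹ (fracAct S σ a) = a := by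
  have h : fracAct S (σ⁻¹ * σ) a = a := by rw [inv_mul_cancel, map_one]; rfl
  rwa [map_mul] at h

theorem fracAct_apply_inv {S : Set (KPrime F M)} (σ : GalGroup F M) (a : Frac S) :
    fracAct S σ (fracAct S σ⁻¹ a) = a := by
  have h : fracAct S (σ * σ⁻¹) a = a := by rw [mul_inv_cancel, map_one]; rfl
  rwa [map_mul] at h

theorem freeSymRep_distRel {S : Set (KPrime F M)} (σ : GalGroup F M) (p : KPrime F M)
    (a : Frac S) : freeSymRep S σ (distRel p a) = distRel p (fracAct S σ a) := by
  unfold distRel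
  rw [map_sub, map_sum, freeSymRep_sym]
  congr 1
  refine Finset.sum_bij' (fun b _ => fracAct S σ b) (fun b _ => fracAct S σ⁻¹ b) ?_ ?_ ?_ ?_ ?_
  · intro b hb
    rw [mem_fiber] at hb ⊢
    rw [← hb, map_nsmul]
  · intro b hb
    rw [mem_fiber] at hb ⊢
    rw [← map_nsmul, hb, fracAct_inv_apply]
  · intro b _; exact fracAct_inv_apply σ b
  · intro b _; exact fracAct_apply_inv σ b
  · intro b _; exact freeSymRep_sym σ b

theorem relations_le_comap (S : Set (KPrime F M)) (σ : GalGroup F M) :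
    relations S ≤ (relations S).comap (freeSymRep S σ) := by
  refine Submodule.span_le.2 ?_
  rintro _ ⟨p, hp, a, ⟨n, hn, ha⟩, rfl⟩
  refine Submodule.subset_span ⟨p, hp, fracAct S σ a, ⟨n, hn, ?_⟩, freeSymRep_distRel σ p a⟩
  have ha' : n • a = 0 := Subtype.ext ha
  have : n • fracAct S σ a = 0 := by rw [← map_nsmul, ha', map_zero]
  simpa using congrArg Subtype.val this

/-- The action of `G` on `U_𝐬`. -/
def uRep (S : Set (KPrime F M)) : Representation ℤ (GalGroup F M) (UDist S) :=
  (freeSymRep S).quotient (relations S) (relations_le_comap S)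

/-- The map `𝒜(𝐬) → 𝒜(𝐬')`, `[a] ↦ [a]`, for `𝐬 ∣ 𝐬'`. -/
def freeSymIncl {S S' : Set (KPrime F M)} (h : S ⊆ S') : FreeSym S →ₗ[ℤ] FreeSym S' :=
  Finsupp.lmapDomain ℤ ℤ (AddSubgroup.inclusion (frac_mono h))

theorem freeSymIncl_sym {S S' : Set (KPrime F M)} (h : S ⊆ S') (a : Frac S) :
    freeSymIncl h (sym a) = sym (AddSubgroup.inclusion (frac_mono h) a) := by
  simp [freeSymIncl, Finsupp.mapDomain_single]

theorem relations_le_comap_incl {S S' : Set (KPrime F M)} (h : S ⊆ S') :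
    relations S ≤ (relations S').comap (freeSymIncl h) := by
  refine Submodule.span_le.2 ?_
  rintro _ ⟨p, hp, a, ⟨n, hn, ha⟩, rfl⟩
  refine Submodule.subset_span ⟨p, h hp, AddSubgroup.inclusion (frac_mono h) a,
    ⟨n, hn.mono (Set.sdiff_subset_sdiff_left h), ha⟩, ?_⟩
  unfold distRel
  rw [map_sub, map_sum, freeSymIncl_sym]
  congr 1
  refine Finset.sum_bij (fun b _ => AddSubgroup.inclusion (frac_mono h) b) ?_ ?_ ?_ ?_
  · intro b hb
    rw [mem_fiber] at hb ⊢
    rw [← hb, map_nsmul]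
  · intro b _ c _ hbc
    exact AddSubgroup.inclusion_injective (frac_mono h) hbc
  · intro b hb
    rw [mem_fiber] at hb
    have hb' : (p : ℕ) • (b : AddCircle (1 : ℚ)) = a := by
      simpa using congrArg Subtype.val hb
    refine ⟨⟨b, (p : ℕ) * n, hn.mul_prime hp, ?_⟩, mem_fiber.2 (Subtype.ext hb'), rfl⟩
    rw [mul_comm, mul_smul, hb', ha]
  · intro b _; exact freeSymIncl_sym h b

/-- The natural map `U_𝐬 → U_𝐬'`, `[a] ↦ [a]`, for `𝐬 ∣ 𝐬'`. -/
def uIncl {S S' : Set (KPrime F M)} (h : S ⊆ S') : UDist S →ₗ[ℤ] UDist S' :=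
  Submodule.mapQ _ _ (freeSymIncl h) (relations_le_comap_incl h)

/-- `I_ℓ ⊆ U`: the subgroup generated by the classes of `[a] - [b]` with
`a - b ∈ (1/ℓ)ℤ/ℤ`. -/
def IEll (ℓ : KPrime F M) : Submodule ℤ (UDist (Set.univ : Set (KPrime F M))) :=
  Submodule.span ℤ {x | ∃ a b : Frac (Set.univ : Set (KPrime F M)), (ℓ : ℕ) • (a - b) = 0 ∧
    x = (relations Set.univ).mkQ (sym a - sym b)}

/-! ### Reduction modulo `M` and invariants -/

/-- The subgroup `M U_𝐬` of `U_𝐬`. -/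
def mulM (S : Set (KPrime F M)) : Submodule ℤ (UDist S) :=
  LinearMap.range (LinearMap.lsmul ℤ (UDist S) (M : ℤ))

theorem mulM_le_comap {S S' : Set (KPrime F M)} (f : UDist S →ₗ[ℤ] UDist S') :
    mulM S ≤ (mulM S').comap f := by
  rintro _ ⟨x, rfl⟩
  exact ⟨f x, by simp⟩

/-- The group `U_𝐬/MU_𝐬`. -/
abbrev UMod (S : Set (KPrime F M)) : Type := UDist S ⧸ mulM S

/-- The reduction map `U_𝐬 → U_𝐬/MU_𝐬`. -/
abbrev red {S : Set (KPrime F M)} : UDist S →ₗ[ℤ] UMod S := (mulM S).mkQ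

/-- The action of `G` on `U_𝐬/MU_𝐬`. -/
def uModRep (S : Set (KPrime F M)) : Representation ℤ (GalGroup F M) (UMod S) :=
  (uRep S).quotient (mulM S) fun σ => mulM_le_comap (uRep S σ)

/-- The group `H⁰(G, U_𝐬/MU_𝐬)`. -/
abbrev H0 (S : Set (KPrime F M)) : Submodule ℤ (UMod S) := (uModRep S).invariants

/-- The natural map `U_𝐬/MU_𝐬 → U_𝐬'/MU_𝐬'` for `𝐬 ∣ 𝐬'`. -/
def uModIncl {S S' : Set (KPrime F M)} (h : S ⊆ S') : UMod S →ₗ[ℤ] UMod S' :=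
  Submodule.mapQ _ _ (uIncl h) (mulM_le_comap (uIncl h))

/-- The defining property of `D_ℓ`. For all `x ∈ U` and `y ∈ U_{𝐫/ℓ}` that represent classes in
`H⁰(G, U/MU)` and `H⁰(G, U_{𝐫/ℓ}/MU_{𝐫/ℓ})`, and for `u = (σ - 1)x/M` in `U` and
`v = (ℓ - φ)y/M` in `U_{𝐫/ℓ}`: one has `u ≡ v mod I_ℓ` if and only if `D x = y`. -/
def Characterizes (ℓ : KPrime F M) (σ φ : GalGroup F M)
    (D : H0 (Set.univ : Set (KPrime F M)) →+ H0 ({ℓ}ᶜ : Set (KPrime F M))) : Prop :=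
  ∀ (x : UDist (Set.univ : Set (KPrime F M))) (y : UDist ({ℓ}ᶜ : Set (KPrime F M)))
    (hx : red x ∈ H0 (Set.univ : Set (KPrime F M))) (hy : red y ∈ H0 ({ℓ}ᶜ : Set (KPrime F M)))
    (u : UDist (Set.univ : Set (KPrime F M))) (v : UDist ({ℓ}ᶜ : Set (KPrime F M))),
    M • u = uRep Set.univ σ x - x →
    M • v = (ℓ : ℕ) • y - uRep {ℓ}ᶜ φ y →
    (u - uIncl (Set.subset_univ _) v ∈ IEll ℓ ↔ D ⟨red x, hx⟩ = ⟨red y, hy⟩)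

end UnivDist

end

noncomputable section

namespace UnivDist

/-! ### Normal forms for distributions -/

section NormalForm

variable {A : Type*} [AddCommGroup A]

/-! Fix a level 𝐬 divisible by `ℓ`, write S for its set of primes and T = S \ {ℓ}. Everything
follows from three facts about `U_S` and `U_T`.

(1) `U_S` is torsion-free (`eq_zero_of_smul_eq_zero`). The relation [pa] = ∑ [a + c], with a of
denominator prime to p and c in the p-torsion, can be solved for the term c = 1/p. Used as a
rewriting rule it eliminates every symbol having some component 1/p. The rewriting terminates and
does not depend on the choice of p, so it defines a linear endomorphism of the free group, congruent
to the identity modulo the relations and with kernel exactly the relations. Hence `U_S` embeds in a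
free group.

(2) `U_T → U_S/I_ℓ` is onto with kernel `(ℓ - Frob)U_T` (`exists_sub_uIncl_mem`,
`uIncl_mem_fiberDiff_iff`). Modulo `I_ℓ` a symbol depends only on its prime-to-ℓ component, and the
relation at ℓ becomes [ℓa] = ℓ[a]. Since ℓ splits completely in F, Frobenius acts on fractions of
denominator prime to ℓ as multiplication by ℓ.

(3) `ℓ - Frob` is injective on `U_T` (`smulSub_injective`), since Frobenius has finite order on each
element and `U_T` is torsion-free.

Given x invariant modulo M, write (σ - 1)x = Mu and choose v in `U_T` with v ≡ u mod `I_ℓ`. Inertia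
moves fractions only by ℓ-torsion, so Mu lies in `I_ℓ`, whence Mv = (ℓ - Frob)y by (2). By (1) and
(3) one may cancel M and ℓ - Frob. This shows that y is invariant modulo M and that its class
depends only on that of x. The construction works at every level, which gives the compatibility with
the divisors r. -/

/-- The subgroup of the elements killed by an integer prime to `p`. -/
def primeToPart (A : Type*) [AddCommGroup A] (p : ℕ) : AddSubgroup A where
  carrier := {a | ∃ n : ℕ, p.Coprime n ∧ n • a = 0}
  zero_mem' := ⟨1, Nat.coprime_one_right p, smul_zero _⟩
  add_mem' := by
    rintro a b ⟨m, hm, ha⟩ ⟨n, hn, hb⟩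
    refine ⟨m * n, Nat.Coprime.mul_right hm hn, ?_⟩
    rw [smul_add, mul_comm, mul_smul, ha, mul_comm, mul_smul, hb, smul_zero, smul_zero, add_zero]
  neg_mem' := by
    rintro a ⟨n, hn, ha⟩
    exact ⟨n, hn, by rw [smul_neg, ha, neg_zero]⟩

theorem mem_primeToPart {p : ℕ} {a : A} :
    a ∈ primeToPart A p ↔ ∃ n : ℕ, p.Coprime n ∧ n • a = 0 := Iff.rfl

theorem eq_zero_of_mem_primeToPart {p : ℕ} {a : A} (ha : a ∈ primeToPart A p)
    (h : p • a = 0) : a = 0 := by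
  obtain ⟨n, hn, hna⟩ := ha
  have h1 := Nat.dvd_gcd (addOrderOf_dvd_of_nsmul_eq_zero h) (addOrderOf_dvd_of_nsmul_eq_zero hna)
  rw [hn, Nat.dvd_one, AddMonoid.addOrderOf_eq_one_iff] at h1
  exact h1

/-- A family of distinct primes `P i`, with the `P i`-torsion of `A` finite, and a nonzero
`P i`-torsion element `e i`. -/
structure PrimeTorsion {ι : Type*} (P : ι → ℕ) (tors : ι → Finset A) (e : ι → A) : Prop where
  prime : ∀ i, (P i).Prime
  inj : Function.Injective P
  mem_tors : ∀ i c, c ∈ tors i ↔ P i • c = 0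
  smul_e : ∀ i, P i • e i = 0
  e_ne : ∀ i, e i ≠ 0
  torsion : ∀ a : A, IsOfFinAddOrder a

namespace PrimeTorsion

variable {ι : Type*} {P : ι → ℕ} {tors : ι → Finset A} {e : ι → A}

/-- The set of the `i` such that the `P i`-component of `b` is `e i`. -/
def bad (P : ι → ℕ) (e : ι → A) (b : A) : Set ι := {i | b - e i ∈ primeToPart A (P i)}

theorem mem_bad {b : A} {i : ι} : i ∈ bad P e b ↔ b - e i ∈ primeToPart A (P i) := Iff.rfl

variable (h : PrimeTorsion P tors e)
include h

theorem mem_primeToPart_of_ne {i j : ι} (hij : i ≠ j) {c : A} (hc : P j • c = 0) :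
    c ∈ primeToPart A (P i) :=
  ⟨P j, (Nat.coprime_primes (h.prime i) (h.prime j)).2 fun H => hij (h.inj H), hc⟩

theorem dvd_addOrderOf {b : A} {i : ι} (hb : i ∈ bad P e b) : P i ∣ addOrderOf b := by
  by_contra hd
  have h1 : b ∈ primeToPart A (P i) :=
    ⟨_, (Nat.Prime.coprime_iff_not_dvd (h.prime i)).2 hd, addOrderOf_nsmul_eq_zero b⟩
  have h2 := sub_mem h1 hb
  rw [sub_sub_cancel] at h2
  exact h.e_ne i (eq_zero_of_mem_primeToPart h2 (h.smul_e i))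

theorem finite_bad (b : A) : (bad P e b).Finite := by
  refine Set.Finite.of_finite_image (f := P) (((addOrderOf b).divisors.finite_toSet).subset ?_)
    h.inj.injOn
  rintro _ ⟨i, hi, rfl⟩
  exact Nat.mem_divisors.2 ⟨h.dvd_addOrderOf hi, (h.torsion b).addOrderOf_pos.ne'⟩

theorem addOrderOf_smul_lt {b : A} {i : ι} (hb : i ∈ bad P e b) :
    addOrderOf (P i • b) < addOrderOf b := by
  rw [(h.torsion b).addOrderOf_nsmul, Nat.gcd_eq_right (h.dvd_addOrderOf hb)]
  exact Nat.div_lt_self (h.torsion b).addOrderOf_pos (h.prime i).one_lt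

theorem addOrderOf_add_le {b : A} {i : ι} (hb : i ∈ bad P e b) {c : A} (hc : P i • c = 0) :
    addOrderOf (b + c) ≤ addOrderOf b := by
  refine Nat.le_of_dvd (h.torsion b).addOrderOf_pos (addOrderOf_dvd_of_nsmul_eq_zero ?_)
  obtain ⟨k, hk⟩ := h.dvd_addOrderOf hb
  rw [smul_add, addOrderOf_nsmul_eq_zero, hk, mul_comm, mul_smul, hc, smul_zero, add_zero]

/-- The index i leaves the bad set because its component is now c ≠ e i. The change c - e i is P
i-torsion, hence has no P j-component for j ≠ i, and no new index enters. -/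
theorem bad_add_ssubset {b : A} {i : ι} (hb : i ∈ bad P e b) {c : A} (hc : P i • c = 0)
    (hce : c ≠ e i) : bad P e (b - e i + c) ⊂ bad P e b := by
  have hi : i ∉ bad P e (b - e i + c) := fun hi => by
    have h1 := sub_mem (mem_bad.1 hi) (mem_bad.1 hb)
    rw [show b - e i + c - e i - (b - e i) = c - e i by abel] at h1
    exact hce (sub_eq_zero.1 (eq_zero_of_mem_primeToPart h1 (by
      rw [smul_sub, hc, h.smul_e, sub_zero])))
  refine (Set.ssubset_iff_of_subset fun j hj => ?_).2 ⟨i, hb, hi⟩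
  have hji : j ≠ i := fun H => hi (H ▸ hj)
  have h1 := add_mem (mem_bad.1 hj) (h.mem_primeToPart_of_ne hji (c := e i - c) (by
    rw [smul_sub, hc, h.smul_e, sub_zero]))
  rwa [show b - e i + c - e j + (e i - c) = b - e j by abel] at h1

/-- The well-founded relation along which normal forms are computed. -/
def rel (P : ι → ℕ) (e : ι → A) (b' b : A) : Prop :=
  Prod.Lex (· < ·) (· < ·) (addOrderOf b', (bad P e b').ncard) (addOrderOf b, (bad P e b).ncard)

omit h in
theorem rel_wf (P : ι → ℕ) (e : ι → A) : WellFounded (rel P e) :=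
  InvImage.wf (fun b => (addOrderOf b, (bad P e b).ncard))
    (WellFounded.prod_lex Nat.lt_wfRel.wf Nat.lt_wfRel.wf)

omit h in
theorem rel_of_lt {b b' : A} (hb : addOrderOf b' < addOrderOf b) : rel P e b' b :=
  Prod.Lex.left _ _ hb

theorem rel_smul {b : A} {i : ι} (hb : i ∈ bad P e b) : rel P e (P i • b) b :=
  rel_of_lt (h.addOrderOf_smul_lt hb)

/-- These terms may keep the order of b, so the number of bad indices serves as the second entry of
the termination measure. -/
theorem rel_add {b : A} {i : ι} (hb : i ∈ bad P e b) {c : A} (hc : P i • c = 0)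
    (hce : c ≠ e i) : rel P e (b - e i + c) b := by
  have h1 : addOrderOf (b - e i + c) ≤ addOrderOf b := by
    rw [show b - e i + c = b + (c - e i) by abel]
    exact h.addOrderOf_add_le hb (by rw [smul_sub, hc, h.smul_e, sub_zero])
  have h2 := Set.ncard_lt_ncard (h.bad_add_ssubset hb hc hce) (h.finite_bad b)
  unfold rel
  rcases h1.lt_or_eq with h1 | h1
  · exact Prod.Lex.left _ _ h1
  · rw [h1]; exact Prod.Lex.right _ h2

omit h in
open Classical in
/-- The normal form of a symbol: as long as some component of `b` is `e i`, it is eliminated by means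
of the distribution relation. -/
def nf (h : PrimeTorsion P tors e) : A → A →₀ ℤ :=
  (rel_wf P e).fix fun b rec =>
    if hb : ∃ i, i ∈ bad P e b then
      rec (P hb.choose • b) (h.rel_smul hb.choose_spec) -
        ∑ c ∈ ((tors hb.choose).erase (e hb.choose)).attach,
          rec (b - e hb.choose + c) (h.rel_add hb.choose_spec
            ((h.mem_tors _ _).1 (Finset.mem_of_mem_erase c.2)) (Finset.ne_of_mem_erase c.2))
    else Finsupp.single b 1

open Classical in
theorem nf_of_forall {b : A} (hb : ¬ ∃ i, i ∈ bad P e b) : nf h b = Finsupp.single b 1 := by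
  rw [nf, WellFounded.fix_eq, dif_neg hb]

open Classical in
theorem exists_nf_eq {b : A} (hb : ∃ i, i ∈ bad P e b) : ∃ i ∈ bad P e b,
    nf h b = nf h (P i • b) - ∑ c ∈ (tors i).erase (e i), nf h (b - e i + c) := by
  refine ⟨hb.choose, hb.choose_spec, ?_⟩
  conv_lhs => rw [nf, WellFounded.fix_eq, dif_pos hb]
  rw [← Finset.sum_attach ((tors hb.choose).erase (e hb.choose))]
  rfl

/-- P i is invertible modulo P j, so multiplication by P i permutes the P j-torsion. -/
theorem sum_tors_smul {B : Type*} [AddCommMonoid B] {i j : ι} (hij : i ≠ j) (f : A → B) :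
    ∑ d ∈ tors j, f (P i • d) = ∑ d ∈ tors j, f d := by
  refine Finset.sum_bij (fun d _ => P i • d) (fun d hd => ?_) (fun d hd d' hd' H => ?_)
    (fun d hd => ?_) fun _ _ => rfl
  · rw [h.mem_tors] at hd ⊢
    rw [smul_comm, hd, smul_zero]
  · rw [h.mem_tors] at hd hd'
    refine sub_eq_zero.1 (eq_zero_of_mem_primeToPart (p := P i) (h.mem_primeToPart_of_ne hij ?_) ?_)
    · rw [smul_sub, hd, hd', sub_zero]
    · rw [smul_sub, sub_eq_zero]; exact H
  · rw [h.mem_tors] at hd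
    obtain ⟨k, hk⟩ := Nat.exists_mul_mod_eq_one_of_coprime
      ((Nat.coprime_primes (h.prime i) (h.prime j)).2 fun H => hij (h.inj H)) (h.prime j).one_lt
    refine ⟨k • d, ?_, ?_⟩
    · rw [h.mem_tors, smul_comm, hd, smul_zero]
    · have h1 := Nat.div_add_mod (P i * k) (P j)
      change P i • k • d = d
      rw [← mul_smul, ← h1, hk.2, add_smul, one_smul, mul_comm, mul_smul, hd, smul_zero, zero_add]

open Classical in
-- Confluence: `nf` picks one bad index i, but any bad j gives the same result. Expanding at i and
-- then j, or at j and then i, produces the same double sum over the torsion. The remaining terms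
-- agree because both groupings in `key2` equal the value at P i P j (b - e i - e j).
theorem nf_eq_of_mem_bad (b : A) : ∀ j ∈ bad P e b,
    nf h b = nf h (P j • b) - ∑ c ∈ (tors j).erase (e j), nf h (b - e j + c) := by
  induction b using (rel_wf P e).induction with
  | _ b ih =>
  intro j hj
  obtain ⟨i, hi, hnf⟩ := h.exists_nf_eq ⟨j, hj⟩
  rcases eq_or_ne i j with rfl | hij
  · exact hnf
  have key : ∀ {i j : ι}, i ≠ j → i ∈ bad P e b → j ∈ bad P e b → ∀ c ∈ (tors i).erase (e i),
      nf h (b - e i + c) = nf h (P j • (b - e i - e j + c)) -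
        ∑ d ∈ (tors j).erase (e j), nf h (b - e i - e j + c + d) := by
    intro i j hij hi hj c hc
    have hc0 := (h.mem_tors _ _).1 (Finset.mem_of_mem_erase hc)
    rw [ih _ (h.rel_add hi hc0 (Finset.ne_of_mem_erase hc)) j ?_]
    · congr 1
      · congr 1
        rw [show b - e i + c = b - e i - e j + c + e j by abel, smul_add, h.smul_e, add_zero]
      · exact Finset.sum_congr rfl fun d _ => by congr 1; abel
    · have h1 := add_mem (mem_bad.1 hj) (h.mem_primeToPart_of_ne hij.symm (c := c - e i) (by
        rw [smul_sub, hc0, h.smul_e, sub_zero]))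
      rwa [mem_bad, show b - e i + c - e j = b - e j + (c - e i) by abel]
  have key2 : ∀ {i j : ι}, i ≠ j → i ∈ bad P e b → j ∈ bad P e b →
      nf h (P i • b) + ∑ d ∈ (tors j).erase (e j), nf h (P i • (b - e i - e j + d)) =
        nf h (P j • P i • (b - e i - e j)) := by
    intro i j hij hi hj
    have hej : e j ∈ tors j := (h.mem_tors _ _).2 (h.smul_e j)
    have hbe : P i • b = P i • (b - e i - e j + e j) := by
      rw [sub_add_cancel, smul_sub, h.smul_e, sub_zero]
    rw [hbe, Finset.add_sum_erase _ (fun d => nf h (P i • (b - e i - e j + d))) hej]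
    simp only [smul_add]
    rw [h.sum_tors_smul hij (fun d => nf h (P i • (b - e i - e j) + d))]
    set a := P i • (b - e i - e j) with ha
    -- If b has order P i * P j * l, then a + e j is killed by P j * l, so its order is strictly
    -- smaller.
    have hrel : rel P e (a + e j) b := by
      refine rel_of_lt ?_
      obtain ⟨k, hk⟩ := h.dvd_addOrderOf hi
      have hN := addOrderOf_nsmul_eq_zero b
      have hpos := (h.torsion b).addOrderOf_pos
      obtain ⟨l, rfl⟩ : P j ∣ k := by
        refine Nat.Coprime.dvd_of_dvd_mul_left ((Nat.coprime_primes (h.prime j) (h.prime i)).2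
          fun H => hij (h.inj H).symm) (hk ▸ h.dvd_addOrderOf hj)
      have h1 : (P j * l) • (a + e j) = 0 := by
        rw [hk, mul_comm, mul_smul] at hN
        have h2 : (P j * l) • P i • e i = 0 := by rw [h.smul_e, smul_zero]
        have h3 : (P j * l) • P i • e j = 0 := by
          rw [mul_comm, mul_smul, smul_comm (P j), h.smul_e, smul_zero, smul_zero]
        have h4 : (P j * l) • e j = 0 := by rw [mul_comm, mul_smul, h.smul_e, smul_zero]
        rw [ha, smul_add, smul_sub, smul_sub, smul_sub, smul_sub, hN, h2, h3, h4]
        simp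
      have hl : 0 < P j * l := Nat.pos_of_ne_zero fun H => by simp [hk, H] at hpos
      refine (Nat.le_of_dvd hl (addOrderOf_dvd_of_nsmul_eq_zero h1)).trans_lt ?_
      rw [hk]
      exact lt_mul_of_one_lt_left hl (h.prime i).one_lt
    have hbad : j ∈ bad P e (a + e j) := by
      rw [mem_bad, add_sub_cancel_right]
      refine nsmul_mem ?_ _
      rw [sub_right_comm]
      exact sub_mem hj (h.mem_primeToPart_of_ne hij.symm (h.smul_e i))
    rw [← Finset.add_sum_erase _ _ hej, ih (a + e j) hrel j hbad, smul_add, h.smul_e, add_zero,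
      add_sub_cancel_right, sub_add_cancel]
  rw [hnf, Finset.sum_congr rfl (key hij hi hj), Finset.sum_congr rfl (key hij.symm hj hi),
    Finset.sum_sub_distrib, Finset.sum_sub_distrib, Finset.sum_comm]
  have e1 := key2 hij hi hj
  have e2 := key2 hij.symm hj hi
  rw [smul_comm, sub_right_comm b (e j) (e i), ← e1] at e2
  simp only [sub_right_comm b (e j) (e i), add_right_comm (b - e i - e j)]
  rw [sub_sub_eq_add_sub, sub_sub_eq_add_sub, sub_eq_sub_iff_add_eq_add, add_right_comm,
    add_right_comm (nf h (P j • b)), e2]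

/-- This is the rewriting rule for a + e i, which is bad at i; the term c = e i goes back into the
sum. -/
theorem nf_smul {i : ι} {a : A} (ha : a ∈ primeToPart A (P i)) :
    nf h (P i • a) = ∑ c ∈ tors i, nf h (a + c) := by
  classical
  rw [← Finset.add_sum_erase _ _ ((h.mem_tors _ _).2 (h.smul_e i)),
    h.nf_eq_of_mem_bad (a + e i) i (by rwa [mem_bad, add_sub_cancel_right]), smul_add, h.smul_e,
    add_zero, add_sub_cancel_right, sub_add_cancel]

/-- Each rewriting step changes the symbol by a generator of the relations; well-founded induction
adds up these changes. -/
theorem nf_sub_single_mem (R : Submodule ℤ (A →₀ ℤ))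
    (hR : ∀ i, ∀ a ∈ primeToPart A (P i),
      Finsupp.single (P i • a) 1 - ∑ c ∈ tors i, Finsupp.single (a + c) 1 ∈ R) (b : A) :
    nf h b - Finsupp.single b 1 ∈ R := by
  classical
  induction b using (rel_wf P e).induction with
  | _ b ih =>
  by_cases hb : ∃ i, i ∈ bad P e b
  · obtain ⟨i, hi, hnf⟩ := h.exists_nf_eq hb
    have h1 := hR i _ hi
    rw [← Finset.add_sum_erase _ _ ((h.mem_tors _ _).2 (h.smul_e i)), sub_add_cancel, smul_sub,
      h.smul_e, sub_zero] at h1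
    have h2 := Submodule.sum_mem R fun c (hc : c ∈ (tors i).erase (e i)) =>
      ih _ (h.rel_add hi ((h.mem_tors _ _).1 (Finset.mem_of_mem_erase hc))
        (Finset.ne_of_mem_erase hc))
    rw [Finset.sum_sub_distrib] at h2
    have h3 := add_mem (sub_mem (ih _ (h.rel_smul hi)) h2) h1
    rw [hnf]
    convert h3 using 1
    abel
  · rw [h.nf_of_forall hb, sub_self]
    exact zero_mem R

end PrimeTorsion

end NormalForm

variable {F : Type*} [Field F] [NumberField F] {M : ℕ}

/-! ### The universal distribution is torsion-free -/

theorem mem_frac_diff_iff {S : Set (KPrime F M)} {p : KPrime F M} {a : Frac S} :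
    (a : AddCircle (1 : ℚ)) ∈ Frac (S \ {p}) ↔ a ∈ primeToPart (Frac S) p := by
  constructor
  · rintro ⟨n, hn, ha⟩
    refine ⟨n, (Nat.Prime.coprime_iff_not_dvd p.2.prime).2 fun hd => ?_, Subtype.ext ha⟩
    obtain ⟨_, hx⟩ := hn.mem p p.2.prime hd
    exact hx.2 rfl
  · rintro ⟨n, hn, ha⟩
    obtain ⟨m, hm, -, hd⟩ := addOrderOf_dvd a
    refine ⟨addOrderOf a, ⟨hm.squarefree.squarefree_of_dvd hd, fun q hq hqd => ?_⟩, ?_⟩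
    · obtain ⟨hk, hqS⟩ := hm.mem q hq (hqd.trans hd)
      refine ⟨hk, hqS, fun H => ?_⟩
      rw [Set.mem_singleton_iff] at H
      have h1 : q ∣ n := hqd.trans (addOrderOf_dvd_of_nsmul_eq_zero ha)
      have h2 : (p : ℕ) = q := congrArg Subtype.val H.symm
      rw [h2] at hn
      exact (Nat.Prime.coprime_iff_not_dvd hq).1 hn h1
    · exact congrArg Subtype.val (addOrderOf_nsmul_eq_zero a)

theorem dividesSuper_prime {S : Set (KPrime F M)} {p : KPrime F M} (hp : p ∈ S) :
    DividesSuper (p : ℕ) S := by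
  simpa using DividesSuper.mul_prime hp (dividesSuper_one (S \ {p}))

/-- The fraction `1 / p`. -/
def oneDiv {S : Set (KPrime F M)} (p : S) : Frac S :=
  ⟨((1 / ((p : KPrime F M) : ℕ) : ℚ) : AddCircle (1 : ℚ)), _, dividesSuper_prime p.2, by
    have := p.1.2.prime.ne_zero
    rw [← AddCircle.coe_nsmul, nsmul_eq_mul, mul_one_div_cancel (by exact_mod_cast this)]
    exact AddCircle.coe_period 1⟩

theorem addOrderOf_oneDiv {S : Set (KPrime F M)} (p : S) :
    addOrderOf (oneDiv p) = ((p : KPrime F M) : ℕ) := by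
  have : Fact ((0 : ℚ) < 1) := ⟨one_pos⟩
  rw [← AddSubgroup.addOrderOf_coe]
  exact AddCircle.addOrderOf_period_div p.1.2.prime.pos

theorem primeTorsion (S : Set (KPrime F M)) :
    PrimeTorsion (A := Frac S) (fun p : S => ((p : KPrime F M) : ℕ)) (fun p => fiber p.1 0)
      oneDiv where
  prime p := p.1.2.prime
  inj p q h := Subtype.ext (Subtype.ext h)
  mem_tors p c := mem_fiber
  smul_e p := by
    conv_lhs => rw [← addOrderOf_oneDiv p]
    exact addOrderOf_nsmul_eq_zero _
  e_ne p h := by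
    have h1 := addOrderOf_oneDiv p
    rw [h, addOrderOf_zero] at h1
    exact p.1.2.prime.ne_one h1.symm
  torsion a := addOrderOf_pos_iff.1 (NeZero.pos _)

theorem sum_fiber_smul {S : Set (KPrime F M)} {B : Type*} [AddCommMonoid B] (p : KPrime F M)
    (a : Frac S) (f : Frac S → B) :
    ∑ b ∈ fiber p ((p : ℕ) • a), f b = ∑ c ∈ fiber p 0, f (a + c) := by
  refine (Finset.sum_bij' (fun c _ => a + c) (fun b _ => b - a) ?_ ?_ ?_ ?_ ?_).symm
  · intro c hc
    rw [mem_fiber] at hc ⊢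
    rw [smul_add, hc, add_zero]
  · intro b hb
    rw [mem_fiber] at hb ⊢
    rw [smul_sub, hb, sub_self]
  · intros; abel
  · intros; abel
  · intros; rfl

theorem distRel_smul {S : Set (KPrime F M)} (p : KPrime F M) (a : Frac S) :
    distRel p ((p : ℕ) • a) = sym ((p : ℕ) • a) - ∑ c ∈ fiber p 0, sym (a + c) := by
  rw [distRel, sum_fiber_smul]

/-- Multiplication by `p` is bijective on the prime-to-`p` part. -/
theorem exists_smul_eq_of_mem_primeToPart {A : Type*} [AddCommGroup A] {p : ℕ} {a : A}
    (ha : a ∈ primeToPart A p) : ∃ b ∈ primeToPart A p, p • b = a := by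
  obtain ⟨n, hn, h⟩ := ha
  have h1 := Int.gcd_eq_gcd_ab p n
  rw [Int.gcd_natCast_natCast, hn, Nat.cast_one] at h1
  refine ⟨(Int.gcdA p n) • a, zsmul_mem (mem_primeToPart.2 ⟨n, hn, h⟩) _, ?_⟩
  conv_rhs => rw [← one_zsmul a, h1, add_smul, mul_comm (n : ℤ), mul_smul _ (n : ℤ),
    natCast_zsmul, h, smul_zero, add_zero, mul_smul, natCast_zsmul]

theorem distRel_smul_mem {S : Set (KPrime F M)} {p : KPrime F M} (hp : p ∈ S) {a : Frac S}
    (ha : a ∈ primeToPart (Frac S) p) : distRel p ((p : ℕ) • a) ∈ relations S :=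
  Submodule.subset_span ⟨p, hp, _, mem_frac_diff_iff.2 (nsmul_mem ha _), rfl⟩

/-- A linear map kills the relations if it kills those parametrized by the prime-to-`p` parts. -/
theorem relations_le {S : Set (KPrime F M)} {N : Submodule ℤ (FreeSym S)}
    (h : ∀ p ∈ S, ∀ a ∈ primeToPart (Frac S) p,
      sym ((p : ℕ) • a) - ∑ c ∈ fiber p 0, sym (a + c) ∈ N) : relations S ≤ N := by
  refine Submodule.span_le.2 ?_
  rintro _ ⟨p, hp, a, ha, rfl⟩
  obtain ⟨b, hb, rfl⟩ := exists_smul_eq_of_mem_primeToPart (mem_frac_diff_iff.1 ha)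
  rw [distRel_smul]
  exact h p hp b hb

/-- Reduction to normal form, as a linear map. -/
def nfMap (S : Set (KPrime F M)) : FreeSym S →ₗ[ℤ] FreeSym S :=
  Finsupp.linearCombination ℤ (primeTorsion S).nf

theorem nfMap_sym {S : Set (KPrime F M)} (a : Frac S) :
    nfMap S (sym a) = (primeTorsion S).nf a := by
  simp [nfMap]

theorem relations_le_ker_nfMap (S : Set (KPrime F M)) :
    relations S ≤ LinearMap.ker (nfMap S) := by
  refine relations_le fun p hp a ha => ?_
  rw [LinearMap.mem_ker, map_sub, map_sum, sub_eq_zero]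
  simp only [nfMap_sym]
  exact (primeTorsion S).nf_smul (i := ⟨p, hp⟩) ha

theorem nfMap_sub_mem {S : Set (KPrime F M)} (f : FreeSym S) : nfMap S f - f ∈ relations S := by
  have h1 (b : Frac S) : nfMap S (sym b) - sym b ∈ relations S := by
    rw [nfMap_sym]
    refine (primeTorsion S).nf_sub_single_mem _ (fun p a ha => ?_) b
    rw [← distRel_smul]
    exact distRel_smul_mem p.2 ha
  induction f using Finsupp.induction_linear with
  | zero => simp
  | add f g hf hg =>
    rw [map_add, add_sub_add_comm]
    exact add_mem hf hg
  | single a n =>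
    have h2 := (relations S).smul_mem n (h1 a)
    rwa [smul_sub, ← map_smul, Finsupp.smul_single, smul_eq_mul, mul_one] at h2

/-- If n f is a relation, then n times the normal form of f vanishes in a free group. So the normal
form is 0, and f, being congruent to it, is a relation. -/
theorem eq_zero_of_smul_eq_zero {S : Set (KPrime F M)} {n : ℤ} (hn : n ≠ 0) {x : UDist S}
    (h : n • x = 0) : x = 0 := by
  obtain ⟨f, rfl⟩ := Submodule.mkQ_surjective _ x
  rw [← map_smul, Submodule.mkQ_apply, Submodule.Quotient.mk_eq_zero] at h
  have h1 := relations_le_ker_nfMap S h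
  rw [LinearMap.mem_ker, map_smul, smul_eq_zero, or_iff_right hn] at h1
  have h2 := nfMap_sub_mem f
  rw [h1, zero_sub, neg_mem_iff] at h2
  exact (Submodule.Quotient.mk_eq_zero _).2 h2

theorem eq_of_smul_eq {S : Set (KPrime F M)} {n : ℤ} (hn : n ≠ 0) {x y : UDist S}
    (h : n • x = n • y) : x = y :=
  sub_eq_zero.1 (eq_zero_of_smul_eq_zero hn (by rw [smul_sub, h, sub_self]))

/-! ### Symbols -/

/-- The class of the symbol `[a]` in `U_𝐬`. -/
def cls {S : Set (KPrime F M)} (a : Frac S) : UDist S := (relations S).mkQ (sym a)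

theorem cls_smul {S : Set (KPrime F M)} {p : KPrime F M} (hp : p ∈ S) {a : Frac S}
    (ha : a ∈ primeToPart (Frac S) p) :
    cls ((p : ℕ) • a) = ∑ c ∈ fiber p 0, cls (a + c) := by
  have h := (Submodule.Quotient.mk_eq_zero _).2 (distRel_smul_mem hp ha)
  rw [distRel_smul, ← Submodule.mkQ_apply, map_sub, map_sum, sub_eq_zero] at h
  exact h

theorem mem_of_forall_cls_mem {S : Set (KPrime F M)} {N : Submodule ℤ (UDist S)}
    (h : ∀ a : Frac S, cls a ∈ N) (x : UDist S) : x ∈ N := by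
  obtain ⟨f, rfl⟩ := Submodule.mkQ_surjective _ x
  induction f using Finsupp.induction_linear with
  | zero => simp
  | add f g hf hg => rw [map_add]; exact add_mem hf hg
  | single a n =>
    have h2 := N.smul_mem n (h a)
    rwa [cls, ← map_smul, Finsupp.smul_single, smul_eq_mul, mul_one] at h2

theorem hom_ext_cls {S : Set (KPrime F M)} {B : Type*} [AddCommGroup B] {f g : UDist S →ₗ[ℤ] B}
    (h : ∀ a : Frac S, f (cls a) = g (cls a)) : f = g :=
  LinearMap.ext fun x => mem_of_forall_cls_mem (N := LinearMap.eqLocus f g) h x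

theorem uRep_cls {S : Set (KPrime F M)} (g : GalGroup F M) (a : Frac S) :
    uRep S g (cls a) = cls (fracAct S g a) := by
  rw [cls, cls, ← freeSymRep_sym]
  rfl

theorem uIncl_cls {S T : Set (KPrime F M)} (h : T ⊆ S) (a : Frac T) :
    uIncl h (cls a) = cls (AddSubgroup.inclusion (frac_mono h) a) := by
  rw [cls, cls, ← freeSymIncl_sym]
  rfl

theorem inclusion_fracAct {S T : Set (KPrime F M)} (h : T ⊆ S) (g : GalGroup F M) (a : Frac T) :
    AddSubgroup.inclusion (frac_mono h) (fracAct T g a) =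
      fracAct S g (AddSubgroup.inclusion (frac_mono h) a) := by
  obtain ⟨n, hn, ha, -⟩ := addOrderOf_dvd a
  obtain ⟨k, -, hk⟩ := exists_fracActFun_eq (hn.mono (Set.subset_univ T)) g
  change AddSubgroup.inclusion (frac_mono h) (fracActFun T g a) = fracActFun S g _
  rw [hk T a ha, hk S _ (by rw [← map_nsmul, ha, map_zero]), map_nsmul]

theorem fracAct_comm {S : Set (KPrime F M)} (g g' : GalGroup F M) (a : Frac S) :
    fracAct S g (fracAct S g' a) = fracAct S g' (fracAct S g a) := by
  obtain ⟨n, hn, ha, -⟩ := addOrderOf_dvd a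
  obtain ⟨k, -, hk⟩ := exists_fracActFun_eq (hn.mono (Set.subset_univ S)) g
  obtain ⟨k', -, hk'⟩ := exists_fracActFun_eq (hn.mono (Set.subset_univ S)) g'
  change fracActFun S g (fracActFun S g' a) = fracActFun S g' (fracActFun S g a)
  rw [hk S a ha, hk' S a ha, hk S _ (by rw [smul_comm, ha, smul_zero]),
    hk' S _ (by rw [smul_comm, ha, smul_zero]), smul_comm]

theorem uIncl_uRep {S T : Set (KPrime F M)} (h : T ⊆ S) (g : GalGroup F M) (x : UDist T) :
    uIncl h (uRep T g x) = uRep S g (uIncl h x) := by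
  refine LinearMap.congr_fun (hom_ext_cls (f := uIncl h ∘ₗ uRep T g) (g := uRep S g ∘ₗ uIncl h)
    fun a => ?_) x
  simp only [LinearMap.comp_apply, uRep_cls, uIncl_cls]
  rw [inclusion_fracAct h]

theorem uRep_comm {S : Set (KPrime F M)} (g g' : GalGroup F M) (x : UDist S) :
    uRep S g (uRep S g' x) = uRep S g' (uRep S g x) := by
  refine LinearMap.congr_fun (hom_ext_cls (f := uRep S g ∘ₗ uRep S g')
    (g := uRep S g' ∘ₗ uRep S g) fun a => ?_) x
  simp [uRep_cls, fracAct_comm g g']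

theorem uIncl_uIncl {S T R : Set (KPrime F M)} (h : T ⊆ S) (h' : R ⊆ T) (x : UDist R) :
    uIncl h (uIncl h' x) = uIncl (h'.trans h) x := by
  refine LinearMap.congr_fun (hom_ext_cls (f := uIncl h ∘ₗ uIncl h') (g := uIncl (h'.trans h))
    fun a => ?_) x
  simp only [LinearMap.comp_apply, uIncl_cls]
  rfl

/-! ### The fractions with denominator prime to `ℓ` -/

theorem card_fiber_zero {S : Set (KPrime F M)} {p : KPrime F M} (hp : p ∈ S) :
    (fiber p (0 : Frac S)).card = p := by
  have h0 : (p : ℕ) ≠ 0 := p.2.prime.ne_zero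
  refine le_antisymm ?_ ?_
  · have h1 := AddCircle.card_torsion_le_of_isSMulRegular (1 : ℚ) p h0
      (fun x y h => by simpa [h0] using h)
    have hfin := AddCircle.finite_torsion_of_isSMulRegular (1 : ℚ) p
      (fun x y h => by simpa [h0] using h)
    have h2 : (fiber p (0 : Frac S) : Set (Frac S)).ncard ≤
        {x : AddCircle (1 : ℚ) | (p : ℕ) • x = 0}.ncard := by
      refine Set.ncard_le_ncard_of_injOn (fun x => (x : AddCircle (1 : ℚ))) (fun x hx => ?_)
        Subtype.val_injective.injOn hfin
      have hx := mem_fiber.1 hx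
      exact congrArg Subtype.val hx
    rw [Set.ncard_coe_finset] at h2
    refine h2.trans ?_
    rw [← hfin.cast_ncard_eq] at h1
    exact_mod_cast h1
  · have h1 : (AddSubgroup.zmultiples (oneDiv ⟨p, hp⟩) : Set (Frac S)) ⊆
        (fiber p (0 : Frac S) : Set (Frac S)) := by
      rintro _ ⟨k, rfl⟩
      refine mem_fiber.2 ?_
      change (p : ℕ) • k • oneDiv ⟨p, hp⟩ = 0
      rw [smul_comm, (primeTorsion S).smul_e ⟨p, hp⟩, smul_zero]
    have h2 := Set.ncard_le_ncard h1
    rw [Set.ncard_coe_finset] at h2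
    refine le_trans (le_of_eq ?_) h2
    have h3 := Nat.card_zmultiples (oneDiv (S := S) ⟨p, hp⟩)
    rw [addOrderOf_oneDiv] at h3
    exact h3.symm

/-- Denominators are squarefree: if p divides the denominator n, the cofactor n / p is prime to p
and kills p a. -/
theorem nsmul_mem_primeToPart {S : Set (KPrime F M)} (p : KPrime F M) (a : Frac S) :
    (p : ℕ) • a ∈ primeToPart (Frac S) p := by
  obtain ⟨n, hn, ha, -⟩ := addOrderOf_dvd a
  by_cases hd : (p : ℕ) ∣ n
  · obtain ⟨m, rfl⟩ := hd
    exact ⟨m, Nat.coprime_of_squarefree_mul hn.squarefree, by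
      rw [← mul_smul, mul_comm]; exact ha⟩
  · exact nsmul_mem (mem_primeToPart.2
      ⟨n, (Nat.Prime.coprime_iff_not_dvd p.2.prime).2 hd, ha⟩) _

section Projection

variable {S T : Set (KPrime F M)} {ℓ : KPrime F M} (hT : T = S \ {ℓ})
include hT

theorem subset_of_eq_diff : T ⊆ S := hT ▸ Set.sdiff_subset

theorem inclusion_mem_primeToPart (a : Frac T) :
    AddSubgroup.inclusion (frac_mono (subset_of_eq_diff hT)) a ∈ primeToPart (Frac S) ℓ := by
  subst hT
  exact mem_frac_diff_iff.1 a.2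

/-- The prime-to-ℓ component of b is obtained by dividing ℓ b, which has no ℓ-part, by ℓ inside the
prime-to-ℓ part. The displayed equation therefore characterizes it. -/
theorem exists_frac_part (b : Frac S) : ∃ a : Frac T,
    (ℓ : ℕ) • AddSubgroup.inclusion (frac_mono (subset_of_eq_diff hT)) a = (ℓ : ℕ) • b := by
  obtain ⟨a, ha, hab⟩ := exists_smul_eq_of_mem_primeToPart (nsmul_mem_primeToPart ℓ b)
  exact ⟨⟨a, hT ▸ mem_frac_diff_iff.2 ha⟩, hab⟩

theorem frac_part_unique {a a' : Frac T} (h : (ℓ : ℕ) • a = (ℓ : ℕ) • a') : a = a' := by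
  have h1 := sub_mem (inclusion_mem_primeToPart hT a) (inclusion_mem_primeToPart hT a')
  refine AddSubgroup.inclusion_injective (frac_mono (subset_of_eq_diff hT))
    (sub_eq_zero.1 (eq_zero_of_mem_primeToPart h1 ?_))
  rw [smul_sub, ← map_nsmul, h, map_nsmul, sub_self]

/-- The projection of `(1/𝐬)ℤ/ℤ` to the direct summand of the fractions with denominator prime to
`ℓ`. -/
def proj : Frac S →+ Frac T :=
  have key {a : Frac T} {b : Frac S}
      (h : (ℓ : ℕ) • AddSubgroup.inclusion (frac_mono (subset_of_eq_diff hT)) a = (ℓ : ℕ) • b) :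
      a = (exists_frac_part hT b).choose := by
    refine frac_part_unique hT (AddSubgroup.inclusion_injective
      (frac_mono (subset_of_eq_diff hT)) ?_)
    rw [map_nsmul, map_nsmul, h, (exists_frac_part hT b).choose_spec]
  AddMonoidHom.mk' (fun b => (exists_frac_part hT b).choose) fun b b' => by
    refine (key ?_).symm
    rw [map_add, smul_add, smul_add, (exists_frac_part hT b).choose_spec,
      (exists_frac_part hT b').choose_spec]

theorem smul_inclusion_proj (b : Frac S) :
    (ℓ : ℕ) • AddSubgroup.inclusion (frac_mono (subset_of_eq_diff hT)) (proj hT b) =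
      (ℓ : ℕ) • b :=
  (exists_frac_part hT b).choose_spec

theorem proj_eq {a : Frac T} {b : Frac S}
    (h : (ℓ : ℕ) • AddSubgroup.inclusion (frac_mono (subset_of_eq_diff hT)) a = (ℓ : ℕ) • b) :
    proj hT b = a := by
  refine frac_part_unique hT (AddSubgroup.inclusion_injective (frac_mono (subset_of_eq_diff hT)) ?_)
  rw [map_nsmul, map_nsmul, h, smul_inclusion_proj hT b]

theorem proj_inclusion (a : Frac T) :
    proj hT (AddSubgroup.inclusion (frac_mono (subset_of_eq_diff hT)) a) = a :=
  proj_eq hT rfl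

theorem proj_eq_of_smul_eq {b b' : Frac S} (h : (ℓ : ℕ) • b = (ℓ : ℕ) • b') :
    proj hT b = proj hT b' :=
  proj_eq hT (by rw [smul_inclusion_proj, h])

theorem proj_eq_zero {b : Frac S} (h : (ℓ : ℕ) • b = 0) : proj hT b = 0 :=
  proj_eq hT (by rw [map_zero, smul_zero, h])

/-- For p ≠ ℓ the p-torsion already lies in the prime-to-ℓ part, so the projection is a bijection on
it. -/
theorem sum_fiber_proj {p : KPrime F M} (hp : p ≠ ℓ) {B : Type*} [AddCommMonoid B]
    (f : Frac T → B) :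
    ∑ c ∈ fiber p (0 : Frac S), f (proj hT c) = ∑ c ∈ fiber p (0 : Frac T), f c := by
  refine Finset.sum_bij' (fun c _ => proj hT c)
    (fun c _ => AddSubgroup.inclusion (frac_mono (subset_of_eq_diff hT)) c) ?_ ?_ ?_ ?_ ?_
  · intro c hc
    rw [mem_fiber] at hc ⊢
    rw [← map_nsmul, hc, map_zero]
  · intro c hc
    rw [mem_fiber] at hc ⊢
    rw [← map_nsmul, hc, map_zero]
  · intro c hc
    rw [mem_fiber] at hc
    have h1 : c ∈ primeToPart (Frac S) ℓ :=
      ⟨p, (Nat.coprime_primes ℓ.2.prime p.2.prime).2 fun H => hp (Subtype.ext H.symm), hc⟩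
    have h2 := sub_mem h1 (inclusion_mem_primeToPart hT (proj hT c))
    refine (sub_eq_zero.1 (eq_zero_of_mem_primeToPart h2 ?_)).symm
    rw [smul_sub, smul_inclusion_proj hT, sub_self]
  · intro c _
    exact proj_inclusion hT c
  · intros; rfl

end Projection

/-! ### The quotient by `I_ℓ` -/

/-- The subgroup of `U_𝐬` generated by the classes of `[a] - [b]` with `a - b ∈ (1/ℓ)ℤ/ℤ`. -/
def fiberDiff (S : Set (KPrime F M)) (ℓ : KPrime F M) : Submodule ℤ (UDist S) :=
  Submodule.span ℤ {x | ∃ a b : Frac S, (ℓ : ℕ) • (a - b) = 0 ∧ x = cls a - cls b}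

theorem cls_sub_mem {S : Set (KPrime F M)} {ℓ : KPrime F M} {a b : Frac S}
    (h : (ℓ : ℕ) • (a - b) = 0) : cls a - cls b ∈ fiberDiff S ℓ :=
  Submodule.subset_span ⟨a, b, h, rfl⟩

theorem uIncl_mem_fiberDiff {S T : Set (KPrime F M)} (h : T ⊆ S) {ℓ : KPrime F M} {x : UDist T}
    (hx : x ∈ fiberDiff T ℓ) : uIncl h x ∈ fiberDiff S ℓ := by
  suffices fiberDiff T ℓ ≤ (fiberDiff S ℓ).comap (uIncl h) from this hx
  refine Submodule.span_le.2 ?_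
  rintro _ ⟨a, b, hab, rfl⟩
  rw [SetLike.mem_coe, Submodule.mem_comap, map_sub, uIncl_cls, uIncl_cls]
  exact cls_sub_mem (by rw [← map_sub, ← map_nsmul, hab, map_zero])

theorem uRep_mem_fiberDiff {S : Set (KPrime F M)} {ℓ : KPrime F M} (g : GalGroup F M) {x : UDist S}
    (hx : x ∈ fiberDiff S ℓ) : uRep S g x ∈ fiberDiff S ℓ := by
  suffices fiberDiff S ℓ ≤ (fiberDiff S ℓ).comap (uRep S g) from this hx
  refine Submodule.span_le.2 ?_
  rintro _ ⟨a, b, hab, rfl⟩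
  rw [SetLike.mem_coe, Submodule.mem_comap, map_sub, uRep_cls, uRep_cls]
  exact cls_sub_mem (by rw [← map_sub, ← map_nsmul, hab, map_zero])

theorem uRep_sub_mem_fiberDiff {S : Set (KPrime F M)} {ℓ : KPrime F M} {σ : GalGroup F M}
    (hσ : ∀ a : Frac S, (ℓ : ℕ) • (fracAct S σ a - a) = 0) (x : UDist S) :
    uRep S σ x - x ∈ fiberDiff S ℓ := by
  refine mem_of_forall_cls_mem (N := (fiberDiff S ℓ).comap (uRep S σ - LinearMap.id))
    (fun a => ?_) x
  rw [Submodule.mem_comap, LinearMap.sub_apply, LinearMap.id_apply, uRep_cls]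
  exact cls_sub_mem (hσ a)

/-- The endomorphism `ℓ - φ` of `U_𝐬`. -/
def smulSub (S : Set (KPrime F M)) (ℓ : KPrime F M) (φ : GalGroup F M) : UDist S →ₗ[ℤ] UDist S :=
  (ℓ : ℕ) • LinearMap.id - uRep S φ

theorem smulSub_apply (S : Set (KPrime F M)) (ℓ : KPrime F M) (φ : GalGroup F M) (x : UDist S) :
    smulSub S ℓ φ x = (ℓ : ℕ) • x - uRep S φ x := rfl

theorem smulSub_uRep (S : Set (KPrime F M)) (ℓ : KPrime F M) (φ g : GalGroup F M) (x : UDist S) :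
    smulSub S ℓ φ (uRep S g x) = uRep S g (smulSub S ℓ φ x) := by
  rw [smulSub_apply, smulSub_apply, map_sub, map_nsmul, uRep_comm]

/-! ### The quotient of `U_𝐬` by `I_ℓ`, and the injectivity of `ℓ - Frob` -/

section Frobenius

variable {S T : Set (KPrime F M)} {ℓ : KPrime F M} (hT : T = S \ {ℓ}) {φ : GalGroup F M}
  (hφ : ∀ a : Frac T, fracAct T φ a = (ℓ : ℕ) • a)
include hφ

theorem smulSub_cls (a : Frac T) : smulSub T ℓ φ (cls a) = (ℓ : ℕ) • cls a - cls ((ℓ : ℕ) • a) := by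
  rw [smulSub_apply, uRep_cls, hφ]

include hT

/-- On a symbol, the distribution relation at ℓ turns ℓ[a] - [ℓa] into ∑ ([a] - [a + c]), with c
running over the ℓ elements of the ℓ-torsion. -/
theorem uIncl_smulSub_mem (hℓ : ℓ ∈ S) (x : UDist T) :
    uIncl (subset_of_eq_diff hT) (smulSub T ℓ φ x) ∈ fiberDiff S ℓ := by
  refine mem_of_forall_cls_mem
    (N := (fiberDiff S ℓ).comap (uIncl (subset_of_eq_diff hT) ∘ₗ smulSub T ℓ φ)) (fun a => ?_) x
  rw [Submodule.mem_comap, LinearMap.comp_apply, smulSub_cls hφ, map_sub, map_nsmul, uIncl_cls,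
    uIncl_cls, map_nsmul, cls_smul hℓ (inclusion_mem_primeToPart hT a), ← card_fiber_zero hℓ,
    ← Finset.sum_const, ← Finset.sum_sub_distrib]
  refine sum_mem fun c hc => cls_sub_mem ?_
  rw [sub_add_cancel_left, smul_neg, mem_fiber.1 hc, neg_zero]

/-- The map `U_𝐬 → U_{𝐬/ℓ} / (ℓ - φ)U_{𝐬/ℓ}` induced by the projection. -/
theorem exists_quotientMap (hℓ : ℓ ∈ S) :
    ∃ f : UDist S →ₗ[ℤ] UDist T ⧸ LinearMap.range (smulSub T ℓ φ),
      ∀ a : Frac S, f (cls a) = (LinearMap.range (smulSub T ℓ φ)).mkQ (cls (proj hT a)) := by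
  set N := LinearMap.range (smulSub T ℓ φ) with hN
  let f₀ : FreeSym S →ₗ[ℤ] UDist T ⧸ N :=
    Finsupp.linearCombination ℤ fun a => N.mkQ (cls (proj hT a))
  have hf₀ (a : Frac S) : f₀ (sym a) = N.mkQ (cls (proj hT a)) := by simp [f₀]
  refine ⟨(relations S).liftQ f₀ (relations_le fun p hp a ha => ?_), fun a => ?_⟩
  · rw [LinearMap.mem_ker, map_sub, map_sum]
    simp only [hf₀]
    rw [← map_sum, ← map_sub, Submodule.mkQ_apply, Submodule.Quotient.mk_eq_zero]
    rcases eq_or_ne p ℓ with rfl | hpℓ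
    · have h1 : ∑ c ∈ fiber p 0, cls (proj hT (a + c)) = (p : ℕ) • cls (proj hT a) := by
        conv_rhs => rw [← card_fiber_zero hp, ← Finset.sum_const]
        refine Finset.sum_congr rfl fun c hc => ?_
        rw [map_add, proj_eq_zero hT (mem_fiber.1 hc), add_zero]
      rw [h1, ← neg_sub, map_nsmul, ← smulSub_cls hφ]
      exact neg_mem ⟨_, rfl⟩
    -- For p ≠ ℓ the projection carries the relation to a relation of level T.
    · simp only [map_add, map_nsmul]
      rw [sum_fiber_proj hT hpℓ (fun c => cls (proj hT a + c)), ← cls_smul, sub_self]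
      · exact zero_mem _
      · rw [hT]; exact ⟨hp, hpℓ⟩
      · obtain ⟨n, hn, h⟩ := ha
        exact ⟨n, hn, by rw [← map_nsmul, h, map_zero]⟩
  · exact (Submodule.liftQ_apply _ _ _).trans (hf₀ a)

/-- The map of `exists_quotientMap` kills differences along ℓ-torsion and restricts to the quotient
map on `U_T`, so the kernel is no larger than the range of ℓ - φ. -/
theorem uIncl_mem_fiberDiff_iff (hℓ : ℓ ∈ S) (x : UDist T) :
    uIncl (subset_of_eq_diff hT) x ∈ fiberDiff S ℓ ↔ x ∈ LinearMap.range (smulSub T ℓ φ) := by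
  refine ⟨fun hx => ?_, ?_⟩
  · obtain ⟨f, hf⟩ := exists_quotientMap hT hφ hℓ
    have h1 : fiberDiff S ℓ ≤ LinearMap.ker f := by
      refine Submodule.span_le.2 ?_
      rintro _ ⟨a, b, hab, rfl⟩
      rw [smul_sub, sub_eq_zero] at hab
      rw [SetLike.mem_coe, LinearMap.mem_ker, map_sub, hf, hf, proj_eq_of_smul_eq hT hab, sub_self]
    have h2 : f ∘ₗ uIncl (subset_of_eq_diff hT) = (LinearMap.range (smulSub T ℓ φ)).mkQ :=
      hom_ext_cls fun a => by
        rw [LinearMap.comp_apply, uIncl_cls, hf, proj_inclusion]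
    have h3 := h1 hx
    rw [LinearMap.mem_ker, ← LinearMap.comp_apply, h2] at h3
    exact (Submodule.Quotient.mk_eq_zero _).1 h3
  · rintro ⟨y, rfl⟩
    exact uIncl_smulSub_mem hT hφ hℓ y

omit hφ in
theorem exists_sub_uIncl_mem (x : UDist S) :
    ∃ y : UDist T, x - uIncl (subset_of_eq_diff hT) y ∈ fiberDiff S ℓ := by
  suffices x ∈ fiberDiff S ℓ ⊔ LinearMap.range (uIncl (subset_of_eq_diff hT)) by
    obtain ⟨z, hz, _, ⟨y, rfl⟩, rfl⟩ := Submodule.mem_sup.1 this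
    exact ⟨y, by rwa [add_sub_cancel_right]⟩
  refine mem_of_forall_cls_mem (fun a => ?_) x
  rw [← sub_add_cancel (cls a)
    (cls (AddSubgroup.inclusion (frac_mono (subset_of_eq_diff hT)) (proj hT a)))]
  refine add_mem (Submodule.mem_sup_left (cls_sub_mem ?_)) (Submodule.mem_sup_right ?_)
  · rw [smul_sub, smul_inclusion_proj hT, sub_self]
  · rw [← uIncl_cls (subset_of_eq_diff hT)]
    exact ⟨_, rfl⟩

theorem exists_uRep_pow_eq (x : UDist T) : ∃ m : ℕ, 0 < m ∧ (uRep T φ ^ m) x = x := by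
  let N : Submodule ℤ (UDist T) :=
    { carrier := {x | ∃ m : ℕ, 0 < m ∧ (uRep T φ ^ m) x = x}
      zero_mem' := ⟨1, one_pos, map_zero _⟩
      add_mem' := by
        rintro x y ⟨m, hm, hx⟩ ⟨n, hn, hy⟩
        refine ⟨m * n, Nat.mul_pos hm hn, ?_⟩
        have aux {k : ℕ} {z : UDist T} (hz : (uRep T φ ^ k) z = z) (i : ℕ) :
            (uRep T φ ^ (k * i)) z = z := by
          rw [pow_mul, Module.End.pow_apply]
          exact Function.iterate_fixed hz i
        rw [map_add, aux hx, mul_comm, aux hy]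
      smul_mem' := by
        rintro c x ⟨m, hm, hx⟩
        exact ⟨m, hm, by rw [map_smul, hx]⟩ }
  refine mem_of_forall_cls_mem (N := N) (fun a => ?_) x
  obtain ⟨n, hn, ha⟩ := inclusion_mem_primeToPart hT a
  rw [← map_nsmul, map_eq_zero_iff _ (AddSubgroup.inclusion_injective _)] at ha
  have hn0 : 0 < n := Nat.pos_of_ne_zero fun H => by
    rw [H, Nat.coprime_zero_right] at hn
    exact ℓ.2.prime.ne_one hn
  -- φ acts on a as multiplication by ℓ, and Euler's theorem gives ℓ ^ φ(n) ≡ 1 modulo an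
  -- annihilator n of a prime to ℓ.
  refine ⟨n.totient, Nat.totient_pos.2 hn0, ?_⟩
  have h1 (k : ℕ) : (uRep T φ ^ k) (cls a) = cls ((ℓ : ℕ) ^ k • a) := by
    induction k with
    | zero => simp
    | succ k ih => rw [pow_succ', Module.End.mul_apply, ih, uRep_cls, hφ, pow_succ', mul_smul]
  rw [h1]
  congr 1
  conv_rhs => rw [← one_smul ℕ a]
  exact nsmul_eq_nsmul_iff_modEq.2
    ((Nat.ModEq.pow_totient hn).of_dvd (addOrderOf_dvd_of_nsmul_eq_zero ha))

/-- If φ x = ℓ x and φ ^ m x = x with m > 0, then (ℓ ^ m - 1) x = 0, and torsion-freeness gives x =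
0. -/
theorem smulSub_injective : Function.Injective (smulSub T ℓ φ) := by
  rw [injective_iff_map_eq_zero]
  intro x hx
  rw [smulSub_apply, sub_eq_zero] at hx
  obtain ⟨m, hm, h⟩ := exists_uRep_pow_eq hT hφ x
  have h1 (k : ℕ) : (uRep T φ ^ k) x = (ℓ : ℕ) ^ k • x := by
    induction k with
    | zero => simp
    | succ k ih =>
      rw [pow_succ', Module.End.mul_apply, ih, map_nsmul, ← hx, smul_smul, pow_succ, mul_comm]
  rw [h1] at h
  refine eq_zero_of_smul_eq_zero (n := (ℓ : ℤ) ^ m - 1) ?_ ?_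
  · have h2 : (1 : ℤ) < (ℓ : ℤ) ^ m :=
      one_lt_pow₀ (by exact_mod_cast ℓ.2.prime.one_lt) hm.ne'
    omega
  · rw [sub_smul, one_smul, sub_eq_zero, ← Nat.cast_pow, natCast_zsmul, h]

end Frobenius

/-! ### Inertia and Frobenius -/

theorem fracAct_eq_smul {S : Set (KPrime F M)} {n j : ℕ}
    (hn : DividesSuper n (Set.univ : Set (KPrime F M))) {g : GalGroup F M}
    (hg : ∀ ζ : CycField F M, ζ ^ n = 1 → g ζ = ζ ^ j) {a : Frac S} (ha : n • a = 0) :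
    fracAct S g a = j • a := by
  obtain ⟨k, hk, hk'⟩ := exists_fracActFun_eq hn g
  obtain ⟨ζ, hζ⟩ := exists_primitiveRoot hn
  have : NeZero n := ⟨hn.squarefree.ne_zero⟩
  have h1 := modEq_of_pow_eq hζ ((hk ζ hζ.pow_eq_one).symm.trans (hg ζ hζ.pow_eq_one))
  exact (hk' S a ha).trans
    (nsmul_eq_nsmul_iff_modEq.2 (h1.of_dvd (addOrderOf_dvd_of_nsmul_eq_zero ha)))

theorem natCast_notMem_of_coprime {R : Type*} [CommRing R] {Q : Ideal R} (hQ : Q.IsPrime)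
    {ℓ n : ℕ} (hℓ : (ℓ : R) ∈ Q) (hn : ℓ.Coprime n) : (n : R) ∉ Q := fun h => by
  refine hQ.ne_top ((Ideal.eq_top_iff_one _).2 ?_)
  have h1 := congrArg (Int.cast : ℤ → R) (Int.gcd_eq_gcd_ab ℓ n)
  rw [Int.gcd_natCast_natCast, hn] at h1
  push_cast at h1
  rw [h1]
  exact add_mem (Q.mul_mem_right _ hℓ) (Q.mul_mem_right _ h)

/-- In η ^ n - 1 = (η - 1)(1 + η + ⋯ + η ^ (n - 1)) the second factor is congruent to n modulo Q,
hence nonzero. -/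
theorem eq_one_of_sub_one_mem {R : Type*} [CommRing R] [IsDomain R] {Q : Ideal R} {n : ℕ} {η : R}
    (hη : η ^ n = 1) (hn : (n : R) ∉ Q) (h : η - 1 ∈ Q) : η = 1 := by
  have h1 := geom_sum_mul η n
  rw [hη, sub_self, mul_eq_zero, sub_eq_zero] at h1
  refine h1.resolve_left fun h2 => hn ?_
  have h3 := congrArg (Ideal.Quotient.mk Q) h2
  have h4 : Ideal.Quotient.mk Q η = 1 := by
    rw [← map_one (Ideal.Quotient.mk Q)]; exact Ideal.Quotient.eq.2 h
  rw [← Ideal.Quotient.eq_zero_iff_mem, map_natCast]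
  simpa [h4] using h3

/-- A root of unity as an algebraic integer. -/
theorem exists_integer_pow_eq_one {K : Type*} [Field K] {n : ℕ} (hn : 0 < n) {ζ : K}
    (hζ : ζ ^ n = 1) : ∃ z : 𝓞 K, (z : K) = ζ ∧ z ^ n = 1 := by
  have hint : IsIntegral ℤ ζ := IsIntegral.of_pow hn (by rw [hζ]; exact isIntegral_one)
  exact ⟨⟨ζ, hint⟩, rfl, RingOfIntegers.ext hζ⟩

theorem coe_galGroup_smul (g : GalGroup F M) (z : 𝓞 (CycField F M)) :
    ((g • z : 𝓞 (CycField F M)) : CycField F M) = g z := rfl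

/-- Roots of unity of order prime to ℓ are distinct modulo Q; this is applied to the quotient σ z /
z, which is 1 modulo Q. -/
theorem apply_eq_of_mem_inertia {ℓ : KPrime F M} {σ : GalGroup F M}
    {Q : Ideal (𝓞 (CycField F M))} (hQ : Q.IsPrime) (hℓ : ((ℓ : ℕ) : 𝓞 (CycField F M)) ∈ Q)
    (hσ : σ ∈ Q.inertia (GalGroup F M)) {n : ℕ} (hn : (ℓ : ℕ).Coprime n) {ζ : CycField F M}
    (hζ : ζ ^ n = 1) : σ ζ = ζ := by
  have hn0 : 0 < n := Nat.pos_of_ne_zero fun H => by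
    rw [H, Nat.coprime_zero_right] at hn
    exact ℓ.2.prime.ne_one hn
  obtain ⟨z, rfl, hz⟩ := exists_integer_pow_eq_one hn0 hζ
  have hinv : z * z ^ (n - 1) = 1 := by rw [← pow_succ', Nat.sub_add_cancel hn0, hz]
  have h1 : σ • z * z ^ (n - 1) = 1 := by
    refine eq_one_of_sub_one_mem (n := n) ?_ (natCast_notMem_of_coprime hQ hℓ hn) ?_
    · rw [mul_pow, ← smul_pow', hz, smul_one, one_mul, ← pow_mul, mul_comm, pow_mul, hz, one_pow]
    · rw [← hinv, ← sub_mul]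
      exact Q.mul_mem_right _ (hσ z)
  have h2 : σ • z = z := by
    rw [← mul_one (σ • z), ← hinv, mul_comm z, ← mul_assoc, h1, one_mul]
  rw [← coe_galGroup_smul, h2]

theorem IsInertiaGenerator.smul_fracAct_sub {ℓ : KPrime F M} {σ : GalGroup F M}
    (hσ : IsInertiaGenerator ℓ σ) {S : Set (KPrime F M)} (a : Frac S) :
    (ℓ : ℕ) • (fracAct S σ a - a) = 0 := by
  obtain ⟨Q, hQ, hℓ, hz⟩ := hσ
  have hσQ : σ ∈ Q.inertia (GalGroup F M) := hz ▸ Subgroup.mem_zpowers σ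
  obtain ⟨n, hn, ha⟩ := mem_frac_diff_iff.2 (nsmul_mem_primeToPart ℓ a)
  have hcop : (ℓ : ℕ).Coprime n := (Nat.Prime.coprime_iff_not_dvd ℓ.2.prime).2 fun hd => by
    obtain ⟨_, hx⟩ := hn.mem ℓ ℓ.2.prime hd
    exact hx.2 rfl
  have h1 := fracAct_eq_smul (j := 1) (a := (ℓ : ℕ) • a) (hn.mono (Set.subset_univ _))
    (fun ζ hζ => (apply_eq_of_mem_inertia hQ hℓ hσQ hcop hζ).trans (pow_one ζ).symm)
    (Subtype.ext ha)
  rw [smul_sub, ← map_nsmul, h1, one_smul, sub_self]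

theorem card_quotient_of_splitsCompletely {ℓ : ℕ} (hℓ : ℓ.Prime) (h : SplitsCompletely F ℓ)
    {q : Ideal (𝓞 F)} (hq : q.IsPrime) (hqℓ : (ℓ : 𝓞 F) ∈ q) : Nat.card (𝓞 F ⧸ q) = ℓ := by
  set p : Ideal ℤ := Ideal.span {(ℓ : ℤ)} with hp
  have : Fact ℓ.Prime := ⟨hℓ⟩
  have hpm : p.IsMaximal := Int.ideal_span_isMaximal_of_prime ℓ
  have hlies : q.LiesOver p := by
    refine ⟨hpm.eq_of_le (Ideal.IsPrime.under ℤ q).ne_top ?_⟩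
    rw [hp, Ideal.span_le, Set.singleton_subset_iff, SetLike.mem_coe, Ideal.mem_comap]
    simpa using hqℓ
  have hp0 : p ≠ ⊥ := by simpa [hp] using hℓ.ne_zero
  have hfin : (p.primesOver (𝓞 F)).Finite := IsDedekindDomain.primesOver_finite p (𝓞 F)
  let _ := hfin.fintype
  have h1 := Ideal.sum_ramification_inertia_eq_finrank p (𝓞 F)
  have h2 : ∑ _Q : p.primesOver (𝓞 F), 1 = Module.finrank ℤ (𝓞 F) := by
    rw [RingOfIntegers.rank, ← h, Finset.sum_const, smul_eq_mul, mul_one, Finset.card_univ,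
      ← Nat.card_eq_fintype_card, Nat.card_coe_set_eq]
  have hpos (Q : p.primesOver (𝓞 F)) :
      1 ≤ Q.1.ramificationIdx ℤ * Q.1.inertiaDeg ℤ := by
    have := Q.2.1
    exact Nat.mul_pos (Q.1.ramificationIdx_pos ℤ) (Q.1.inertiaDeg_pos ℤ)
  -- The products e f sum to [F : ℚ] over [F : ℚ] primes and each is at least 1, so each equals 1.
  have h3 := (Finset.sum_eq_sum_iff_of_le fun Q _ => hpos Q).1 (h2.trans h1.symm) ⟨q, hq, hlies⟩
    (Finset.mem_univ _)
  have hqm : q.IsMaximal := Ideal.IsMaximal.of_liesOver_isMaximal q p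
  have h4 := Ideal.cardQuot_pow_inertiaDeg p q
  rw [Nat.eq_one_of_mul_eq_one_left h3.symm, pow_one] at h4
  change q.cardQuot = ℓ
  rw [← h4, hp]
  exact Int.card_ideal_quot ℓ

/-- Frobenius raises roots of unity of order prime to ℓ to the power of the residue field's
cardinality, which is ℓ because ℓ splits completely in F. -/
theorem IsFrobenius.fracAct_eq {ℓ : KPrime F M} {φ : GalGroup F M} (hφ : IsFrobenius ℓ φ)
    {S T : Set (KPrime F M)} (hT : T = S \ {ℓ}) (a : Frac T) : fracAct T φ a = (ℓ : ℕ) • a := by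
  obtain ⟨Q, hQ, hℓ, hfrob⟩ := hφ
  subst hT
  obtain ⟨n, hn, ha⟩ := a.2
  have hcop : (ℓ : ℕ).Coprime n := (Nat.Prime.coprime_iff_not_dvd ℓ.2.prime).2 fun hd => by
    obtain ⟨_, hx⟩ := hn.mem ℓ ℓ.2.prime hd
    exact hx.2 rfl
  have hn0 : 0 < n := Nat.pos_of_ne_zero hn.squarefree.ne_zero
  refine fracAct_eq_smul (hn.mono (Set.subset_univ _)) (fun ζ hζ => ?_) (Subtype.ext ha)
  obtain ⟨z, rfl, hz⟩ := exists_integer_pow_eq_one hn0 hζ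
  have h1 := hfrob.apply_of_pow_eq_one hz (natCast_notMem_of_coprime hQ hℓ hcop)
  rw [card_quotient_of_splitsCompletely ℓ.2.prime ℓ.2.splits (hQ.under _)
    (by rw [Ideal.mem_comap, map_natCast]; exact hℓ)] at h1
  exact congrArg (fun w : 𝓞 (CycField F M) => (w : CycField F M)) h1

/-! ### Kolyvagin recursion -/

theorem red_eq_iff {S : Set (KPrime F M)} {x y : UDist S} :
    red x = red y ↔ ∃ z : UDist S, M • z = x - y := by
  rw [Submodule.mkQ_apply, Submodule.mkQ_apply, Submodule.Quotient.eq, mulM, LinearMap.mem_range]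
  simp only [LinearMap.lsmul_apply, natCast_zsmul]

theorem red_mem_H0_iff {S : Set (KPrime F M)} {x : UDist S} :
    red x ∈ H0 S ↔ ∀ g, ∃ z : UDist S, M • z = uRep S g x - x := by
  rw [Representation.mem_invariants]
  exact forall_congr' fun g => red_eq_iff (x := uRep S g x) (y := x)

theorem eq_of_nsmul_eq (hM : M ≠ 0) {S : Set (KPrime F M)} {x y : UDist S} (h : M • x = M • y) :
    x = y :=
  eq_of_smul_eq (n := (M : ℤ)) (by exact_mod_cast hM) (by simpa using h)

/-- Write ℓ - φ = (ℓ - 1) - (φ - 1): M divides ℓ - 1, and (φ - 1)y is divisible by M by invariance.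
-/
theorem exists_smul_eq_smulSub {S : Set (KPrime F M)} (ℓ : KPrime F M) (φ : GalGroup F M)
    {y : UDist S} (hy : red y ∈ H0 S) : ∃ v : UDist S, M • v = (ℓ : ℕ) • y - uRep S φ y := by
  obtain ⟨z, hz⟩ := red_mem_H0_iff.1 hy φ
  obtain ⟨k, hk⟩ := (Nat.modEq_iff_dvd' ℓ.2.prime.one_lt.le).1 ℓ.2.modEq.symm
  have hl : (ℓ : ℕ) = M * k + 1 := by have := ℓ.2.prime.one_lt; omega
  refine ⟨k • y - z, ?_⟩
  rw [smul_sub, hz, hl, add_smul, one_smul, mul_smul]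
  abel

theorem red_uIncl_mem_H0 {S T : Set (KPrime F M)} (h : T ⊆ S) {x : UDist T} (hx : red x ∈ H0 T) :
    red (uIncl h x) ∈ H0 S := by
  refine red_mem_H0_iff.2 fun g => ?_
  obtain ⟨z, hz⟩ := red_mem_H0_iff.1 hx g
  exact ⟨uIncl h z, by rw [← map_nsmul, hz, map_sub, uIncl_uRep]⟩

/-! ### The recursion from level 𝐬 to level 𝐬/ℓ -/

section Recursion

variable {S T : Set (KPrime F M)} {ℓ : KPrime F M} (hT : T = S \ {ℓ}) (hℓ : ℓ ∈ S) (hM : M ≠ 0)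
  {σ φ : GalGroup F M} (hσ : ∀ a : Frac S, (ℓ : ℕ) • (fracAct S σ a - a) = 0)
  (hφ : ∀ a : Frac T, fracAct T φ a = (ℓ : ℕ) • a)
include hT hℓ hM hσ hφ

theorem exists_recursion {x u : UDist S} (hx : red x ∈ H0 S) (hu : M • u = uRep S σ x - x) :
    ∃ y v : UDist T, red y ∈ H0 T ∧ M • v = (ℓ : ℕ) • y - uRep T φ y ∧
      u - uIncl (subset_of_eq_diff hT) v ∈ fiberDiff S ℓ := by
  obtain ⟨v, hv⟩ := exists_sub_uIncl_mem (ℓ := ℓ) hT u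
  have h1 : uIncl (subset_of_eq_diff hT) (M • v) ∈ fiberDiff S ℓ := by
    have h2 := sub_mem (hu ▸ uRep_sub_mem_fiberDiff hσ x) (nsmul_mem hv M)
    rwa [smul_sub, sub_sub_cancel, ← map_nsmul] at h2
  obtain ⟨y, hy⟩ := (uIncl_mem_fiberDiff_iff hT hφ hℓ _).1 h1
  refine ⟨y, v, red_mem_H0_iff.2 fun g => ?_, by rw [← hy, smulSub_apply], hv⟩
  obtain ⟨x', hx'⟩ := red_mem_H0_iff.1 hx g
  -- With (g - 1)x = Mx', commutativity of the action and cancellation of M give (g - 1)u = (σ -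
  -- 1)x', which lies in `fiberDiff S ℓ`.
  have h3 : uRep S g u - u = uRep S σ x' - x' := by
    refine eq_of_nsmul_eq hM ?_
    rw [smul_sub, smul_sub, ← map_nsmul, ← map_nsmul, hu, hx', map_sub, map_sub, uRep_comm]
    abel
  have h4 : uIncl (subset_of_eq_diff hT) (uRep T g v - v) ∈ fiberDiff S ℓ := by
    have h5 := sub_mem (h3 ▸ uRep_sub_mem_fiberDiff hσ x')
      (sub_mem (uRep_mem_fiberDiff g hv) hv)
    rw [map_sub] at h5
    rw [map_sub, uIncl_uRep]
    convert h5 using 1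
    abel
  obtain ⟨z, hz⟩ := (uIncl_mem_fiberDiff_iff hT hφ hℓ _).1 h4
  -- Since (ℓ - φ)(g - 1)y = M(g - 1)v = (ℓ - φ)Mz, cancelling ℓ - φ gives (g - 1)y = Mz.
  refine ⟨z, smulSub_injective hT hφ ?_⟩
  rw [map_nsmul, hz, map_sub, smulSub_uRep, hy, map_nsmul, smul_sub]

/-- Because u - u' = (σ - 1)w, the congruence for the primed data says v - v' = (ℓ - φ)z for some z.
As M(v - v') = (ℓ - φ)(y - y'), the same z satisfies y - y' = Mz, and conversely. -/
theorem recursion_iff {x x' u u' : UDist S} {y y' v v' : UDist T}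
    (hu : M • u = uRep S σ x - x) (hu' : M • u' = uRep S σ x' - x')
    (hv : M • v = (ℓ : ℕ) • y - uRep T φ y) (hv' : M • v' = (ℓ : ℕ) • y' - uRep T φ y')
    (hxx' : red x = red x') (h : u - uIncl (subset_of_eq_diff hT) v ∈ fiberDiff S ℓ) :
    u' - uIncl (subset_of_eq_diff hT) v' ∈ fiberDiff S ℓ ↔ red y = red y' := by
  obtain ⟨w, hw⟩ := red_eq_iff.1 hxx'
  have h1 : u - u' ∈ fiberDiff S ℓ := by
    have h2 : u - u' = uRep S σ w - w := by
      refine eq_of_nsmul_eq hM ?_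
      rw [smul_sub, smul_sub, hu, hu', ← map_nsmul, hw, map_sub]
      abel
    exact h2 ▸ uRep_sub_mem_fiberDiff hσ w
  have h3 : u' - uIncl (subset_of_eq_diff hT) v' =
      u - uIncl (subset_of_eq_diff hT) v - (u - u') + uIncl (subset_of_eq_diff hT) (v - v') := by
    rw [map_sub]; abel
  have h4 : M • (v - v') = smulSub T ℓ φ (y - y') := by
    rw [smul_sub, hv, hv', map_sub, smulSub_apply, smulSub_apply]
  rw [h3, add_mem_cancel_left (sub_mem h h1), uIncl_mem_fiberDiff_iff hT hφ hℓ, red_eq_iff]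
  refine exists_congr fun z => ⟨fun hz => ?_, fun hz => ?_⟩
  · refine smulSub_injective hT hφ ?_
    rw [map_nsmul, hz, h4]
  · refine eq_of_nsmul_eq hM ?_
    rw [h4, ← hz, map_nsmul]

end Recursion

/-! ### The operator `D_ℓ`: existence, uniqueness, compatibility with levels -/

section Operator

variable {ℓ : KPrime F M} (hM : M ≠ 0) {σ φ : GalGroup F M}
  (hσ : ∀ (S : Set (KPrime F M)) (a : Frac S), (ℓ : ℕ) • (fracAct S σ a - a) = 0)
  (hφ : ∀ S T : Set (KPrime F M), T = S \ {ℓ} → ∀ a : Frac T, fracAct T φ a = (ℓ : ℕ) • a)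
include hM hσ hφ

theorem exists_characterizes :
    ∃ D : H0 (Set.univ : Set (KPrime F M)) →+ H0 ({ℓ}ᶜ : Set (KPrime F M)),
      Characterizes ℓ σ φ D := by
  have hT : ({ℓ}ᶜ : Set (KPrime F M)) = Set.univ \ {ℓ} := Set.compl_eq_univ_sdiff _
  have hφ' := hφ _ _ hT
  have hex (c : H0 (Set.univ : Set (KPrime F M))) :
      ∃ d : H0 ({ℓ}ᶜ : Set (KPrime F M)), ∃ x u y v, red x = c.1 ∧ red y = d.1 ∧
        M • u = uRep Set.univ σ x - x ∧ M • v = (ℓ : ℕ) • y - uRep {ℓ}ᶜ φ y ∧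
        u - uIncl (Set.subset_univ _) v ∈ fiberDiff Set.univ ℓ := by
    obtain ⟨c, hc⟩ := c
    obtain ⟨x, rfl⟩ := Submodule.mkQ_surjective _ c
    obtain ⟨u, hu⟩ := red_mem_H0_iff.1 hc σ
    obtain ⟨y, v, hy, hv, h⟩ := exists_recursion hT (Set.mem_univ ℓ) hM (hσ _) hφ' hc hu
    exact ⟨⟨red y, hy⟩, x, u, y, v, rfl, rfl, hu, hv, h⟩
  choose D x u y v hx hy hu hv h using hex
  refine ⟨AddMonoidHom.mk' D fun c c' => ?_, fun x' y' hx' hy' u' v' hu' hv' => ?_⟩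
  · refine Subtype.ext ?_
    rw [Submodule.coe_add, ← hy, ← hy c, ← hy c', ← map_add]
    -- Additivity: the data chosen for c + c' are compared with the sum of the data chosen for c and
    -- c'.
    refine (recursion_iff hT (Set.mem_univ ℓ) hM (hσ _) hφ' (hu (c + c'))
      (x' := x c + x c') (u' := u c + u c') (v' := v c + v c') ?_ (hv (c + c')) ?_ ?_
      (h (c + c'))).1 ?_
    · rw [smul_add, hu, hu, map_add]; abel
    · rw [smul_add, hv, hv, map_add, smul_add]; abel
    · rw [hx, map_add, hx, hx, Submodule.coe_add]
    · rw [map_add, add_sub_add_comm]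
      exact add_mem (h c) (h c')
  · rw [AddMonoidHom.mk'_apply, Subtype.ext_iff, ← hy]
    -- `IEll ℓ` unfolds to `fiberDiff Set.univ ℓ`, so this is the characterizing equivalence.
    exact recursion_iff hT (Set.mem_univ ℓ) hM (hσ _) hφ' (hu _) hu' (hv _) hv' (hx _) (h _)

omit hM hσ hφ in
-- Testing against a representative y of D c makes the congruence hold, and the property of D' then
-- forces D' c to be the class of y.
theorem Characterizes.unique
    (hdiv : ∀ x : UDist (Set.univ : Set (KPrime F M)), red x ∈ H0 (Set.univ : Set (KPrime F M)) →
      ∃ u, M • u = uRep Set.univ σ x - x)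
    {D D' : H0 (Set.univ : Set (KPrime F M)) →+ H0 ({ℓ}ᶜ : Set (KPrime F M))}
    (hD : Characterizes ℓ σ φ D) (hD' : Characterizes ℓ σ φ D') : D' = D := by
  ext1 c
  obtain ⟨c, hc⟩ := c
  obtain ⟨x, rfl⟩ := Submodule.mkQ_surjective _ c
  obtain ⟨d, hd⟩ : ∃ d, d = D ⟨red x, hc⟩ := ⟨_, rfl⟩
  obtain ⟨d, hd0⟩ := d
  obtain ⟨y, rfl⟩ := Submodule.mkQ_surjective _ d
  obtain ⟨u, hu⟩ := hdiv x hc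
  obtain ⟨v, hv⟩ := exists_smul_eq_smulSub ℓ φ hd0
  rw [← hd]
  exact (hD' x y hc hd0 u v hu hv).1 ((hD x y hc hd0 u v hu hv).2 hd.symm)

omit hM hσ hφ in
theorem level_div_eq {r : ℕ} (hr : DividesSuper r (Set.univ : Set (KPrime F M)))
    (hℓr : (ℓ : ℕ) ∣ r) : level F M (r / ℓ) = level F M r \ {ℓ} := by
  refine Set.Subset.antisymm (fun p hp => ⟨?_, level_div_subset_compl hr hℓr hp⟩) ?_
  · exact dvd_trans (show (p : ℕ) ∣ r / ℓ from hp) (Nat.div_dvd_of_dvd hℓr)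
  · rintro p ⟨hp, hpℓ⟩
    change (p : ℕ) ∣ r / ℓ
    refine (Nat.Coprime.dvd_of_dvd_mul_left ((Nat.coprime_primes p.2.prime ℓ.2.prime).2
      fun H => hpℓ (Subtype.ext H)) ?_ : (p : ℕ) ∣ r / ℓ)
    rw [Nat.mul_div_cancel' hℓr]
    exact hp

/-- The recursion is run at level r and its data u, v, y are pushed up to the full level; the
characterizing property identifies D c with the image of y. -/
theorem Characterizes.map_level
    {D : H0 (Set.univ : Set (KPrime F M)) →+ H0 ({ℓ}ᶜ : Set (KPrime F M))}
    (hD : Characterizes ℓ σ φ D) {r : ℕ} (hr : DividesSuper r (Set.univ : Set (KPrime F M)))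
    (hℓr : (ℓ : ℕ) ∣ r) (c : H0 (Set.univ : Set (KPrime F M)))
    (hc : (c : UMod (Set.univ : Set (KPrime F M))) ∈
      (H0 (level F M r)).map (uModIncl (Set.subset_univ _))) :
    (D c : UMod ({ℓ}ᶜ : Set (KPrime F M))) ∈
      (H0 (level F M (r / ℓ))).map (uModIncl (level_div_subset_compl hr hℓr)) := by
  have hT := level_div_eq hr hℓr
  obtain ⟨c₀, hc₀, hcc⟩ := hc
  obtain ⟨x, rfl⟩ := Submodule.mkQ_surjective _ c₀
  obtain ⟨u, hu⟩ := red_mem_H0_iff.1 hc₀ σ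
  obtain ⟨y, v, hy, hv, h⟩ := exists_recursion hT hℓr hM (hσ _) (hφ _ _ hT) hc₀ hu
  have hc : c = ⟨red (uIncl (Set.subset_univ _) x), red_uIncl_mem_H0 _ hc₀⟩ :=
    Subtype.ext hcc.symm
  have h1 : D c = ⟨red (uIncl (level_div_subset_compl hr hℓr) y), red_uIncl_mem_H0 _ hy⟩ := by
    rw [hc]
    refine (hD _ _ _ _ (uIncl (Set.subset_univ _) u) (uIncl (level_div_subset_compl hr hℓr) v)
      ?_ ?_).1 ?_
    · rw [← map_nsmul, hu, map_sub, uIncl_uRep]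
    · rw [← map_nsmul, hv, map_sub, uIncl_uRep, map_nsmul]
    · have h2 := uIncl_mem_fiberDiff (Set.subset_univ _) h
      rw [map_sub, uIncl_uIncl] at h2
      rw [uIncl_uIncl]
      exact h2
  rw [h1]
  exact ⟨red y, hy, rfl⟩

end Operator

end UnivDist

end

theorem mainTheorem6 (F : Type*) [Field F] [NumberField F] [IsAbelianGalois ℚ F]
    [NumberField.IsTotallyReal F] (M : ℕ) (hM : Odd M)
    (ℓ : UnivDist.KPrime F M) (σ φ : UnivDist.GalGroup F M)
    (hσ : UnivDist.IsInertiaGenerator ℓ σ) (hφ : UnivDist.IsFrobenius ℓ φ) :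
    -- the quotients `(σ - 1)x/M` and `(ℓ - φ)y/M` exist and are unique
    (∀ x : UnivDist.UDist (Set.univ : Set (UnivDist.KPrime F M)),
      UnivDist.red x ∈ UnivDist.H0 (Set.univ : Set (UnivDist.KPrime F M)) →
        ∃! u : UnivDist.UDist (Set.univ : Set (UnivDist.KPrime F M)),
          M • u = UnivDist.uRep Set.univ σ x - x) ∧
    (∀ y : UnivDist.UDist ({ℓ}ᶜ : Set (UnivDist.KPrime F M)),
      UnivDist.red y ∈ UnivDist.H0 ({ℓ}ᶜ : Set (UnivDist.KPrime F M)) →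
        ∃! v : UnivDist.UDist ({ℓ}ᶜ : Set (UnivDist.KPrime F M)),
          M • v = (ℓ : ℕ) • y - UnivDist.uRep {ℓ}ᶜ φ y) ∧
    -- existence and uniqueness of `D`, and compatibility with the levels `r`
    ∃ D : UnivDist.H0 (Set.univ : Set (UnivDist.KPrime F M)) →+
        UnivDist.H0 ({ℓ}ᶜ : Set (UnivDist.KPrime F M)),
      UnivDist.Characterizes ℓ σ φ D ∧
      (∀ D' : UnivDist.H0 (Set.univ : Set (UnivDist.KPrime F M)) →+
        UnivDist.H0 ({ℓ}ᶜ : Set (UnivDist.KPrime F M)),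
        UnivDist.Characterizes ℓ σ φ D' → D' = D) ∧
      ∀ (r : ℕ) (hr : UnivDist.DividesSuper r (Set.univ : Set (UnivDist.KPrime F M)))
        (hℓr : (ℓ : ℕ) ∣ r) (c : UnivDist.H0 (Set.univ : Set (UnivDist.KPrime F M))),
        (c : UnivDist.UMod (Set.univ : Set (UnivDist.KPrime F M))) ∈
          (UnivDist.H0 (UnivDist.level F M r)).map
            (UnivDist.uModIncl (Set.subset_univ _)) →
        (D c : UnivDist.UMod ({ℓ}ᶜ : Set (UnivDist.KPrime F M))) ∈
          (UnivDist.H0 (UnivDist.level F M (r / ℓ))).map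
            (UnivDist.uModIncl (UnivDist.level_div_subset_compl hr hℓr)) := by
  have hM0 : M ≠ 0 := hM.pos.ne'
  have hσ' (S : Set (UnivDist.KPrime F M)) := hσ.smul_fracAct_sub (S := S)
  have hφ' (S T : Set (UnivDist.KPrime F M)) (hT : T = S \ {ℓ}) := hφ.fracAct_eq hT
  refine ⟨fun x hx => ?_, fun y hy => ?_, ?_⟩
  · obtain ⟨u, hu⟩ := UnivDist.red_mem_H0_iff.1 hx σ
    exact ⟨u, hu, fun u' hu' => UnivDist.eq_of_nsmul_eq hM0 (hu'.trans hu.symm)⟩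
  · obtain ⟨v, hv⟩ := UnivDist.exists_smul_eq_smulSub ℓ φ hy
    exact ⟨v, hv, fun v' hv' => UnivDist.eq_of_nsmul_eq hM0 (hv'.trans hv.symm)⟩
  · obtain ⟨D, hD⟩ := UnivDist.exists_characterizes hM0 hσ' hφ'
    exact ⟨D, hD, fun D' hD' => hD.unique (fun x hx => UnivDist.red_mem_H0_iff.1 hx σ) hD',
      fun r hr hℓr c hc => hD.map_level hM0 hσ' hφ' hr hℓr c hc⟩
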